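/- For $G\ge 1$ let $\mathcal A_G$ denote the single-mode quantum-limited amplifier channel of gain $G$, i.e. the quantum channel (completely positive trace-preserving map) on one bosonic mode that transforms the characteristic function $\chi_\rho(\xi)=\operatorname{Tr}\rho\, e^{\xi \hat a^\dagger-\xi^*\hat a}$ of every state as $\chi_{\rm out}(\xi)=\chi_{\rm in}(\sqrt G\,\xi)\,e^{-(G-1)|\xi|^2/2}$. Let $S$ be a system of $M$ bosonic modes with number states $|\mathbf n\rangle_S$, $\mathbf n=(n_1,\dots,n_M)\in\mathbb N^M$, let $A$ be an arbitrary ancilla (Hilbert space), let $\{|\chi_{\mathbf n}\rangle_A\}_{\mathbf n}$ be an orthonormal family in $A$, and let $\{r_{\mathbf n}\}$ and $\{s_{\mathbf n}\}$ be arbitrary probability distributions on $\mathbb N^M$. Consider the number-diagonal-signal (NDS) states $$|\psi\rangle=\sum_{\mathbf n}\sqrt{r_{\mathbf n}}\,|\chi_{\mathbf n}\rangle_A|\mathbf n\rangle_S,\qquad |\psi'\rangle=\sum_{\mathbf n}\sqrt{s_{\mathbf n}}\,|\chi_{\mathbf n}\rangle_A|\mathbf n\rangle_S ,$$ and, for $G,G'\ge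 1$, the output states $$\rho=(\mathrm{id}_A\otimes\mathcal A_G^{\otimes M})(|\psi\rangle\langle\psi|),\qquad \rho'=(\mathrm{id}_A\otimes\mathcal A_{G'}^{\otimes M})(|\psi'\rangle\langle\psi'|).$$ Then the fidelity $F(\rho,\rho'):=\operatorname{Tr}\sqrt{\sqrt{\rho}\,\rho'\sqrt{\rho}}$ is $$F(\rho,\rho')=\sum_{\mathbf n\in\mathbb N^M}\sqrt{r_{\mathbf n}s_{\mathbf n}}\;\nu^{\,n+M},\qquad n=\sum_{m=1}^M n_m,$$ where $$\nu=\Bigl(\sqrt{GG'}-\sqrt{(G-1)(G'-1)}\Bigr)^{-1}=\operatorname{sech}(\tau'-\tau)\in(0,1],$$ with $\tau,\tau'\ge 0$ defined by $G=\cosh^2\tau$, $G'=\cosh^2\tau'$. -/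

import Mathlib

universe u

noncomputable section

/-! ### Trace, density operators, fidelity -/

/-- `HasTrace T t`: the operator `T` on the Hilbert space `H` has trace `t`, that is,
`∑ i, ⟪b i, T (b i)⟫` converges to `t` for every orthonormal (Hilbert) basis `b` of `H`. -/
def HasTrace {H : Type u} [NormedAddCommGroup H] [InnerProductSpace ℂ H]
    (T : H →L[ℂ] H) (t : ℂ) : Prop :=
  ∀ (ι : Type u) (b : HilbertBasis ι ℂ H), HasSum (fun i => inner ℂ (b i) (T (b i))) t

/-- A density operator (quantum state): a positive operator of trace one. -/
def IsDensityOperator {H : Type u} [NormedAddCommGroup H] [InnerProductSpace ℂ H]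
    (ρ : H →L[ℂ] H) : Prop :=
  ρ.IsPositive ∧ HasTrace ρ 1

/-- `HasFidelity ρ ρ' F`: the fidelity `Tr √(√ρ ρ' √ρ)` of the states `ρ`, `ρ'` equals `F`. The
square roots are the positive square roots of positive bounded operators. -/
def HasFidelity {H : Type u} [NormedAddCommGroup H] [InnerProductSpace ℂ H] [CompleteSpace H]
    (ρ ρ' : H →L[ℂ] H) (F : ℝ) : Prop :=
  HasTrace (CFC.sqrt (CFC.sqrt ρ * ρ' * CFC.sqrt ρ)) (F : ℂ)

/-- The space of trace-class operators on `H`: the linear span of the positive operators of finite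
trace. -/
def traceClass (H : Type u) [NormedAddCommGroup H] [InnerProductSpace ℂ H] :
    Submodule ℂ (H →L[ℂ] H) :=
  Submodule.span ℂ {T | T.IsPositive ∧ ∃ t : ℂ, HasTrace T t}

theorem rankOne_self_mem_traceClass {H : Type u} [NormedAddCommGroup H] [InnerProductSpace ℂ H]
    (x : H) : InnerProductSpace.rankOne ℂ x x ∈ traceClass H := by
  refine Submodule.subset_span ⟨InnerProductSpace.isPositive_rankOne_self x, inner ℂ x x, ?_⟩
  intro ι b
  have h := b.hasSum_inner_mul_inner x x
  refine h.congr_fun fun i => ?_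
  simp [InnerProductSpace.rankOne_apply]

/-- The operators `|x⟩⟨y|` are trace class. -/
theorem rankOne_mem_traceClass {H : Type u} [NormedAddCommGroup H] [InnerProductSpace ℂ H]
    (x y : H) : InnerProductSpace.rankOne ℂ x y ∈ traceClass H := by
  have key : InnerProductSpace.rankOne ℂ x y = (1 / 4 : ℂ) •
      (InnerProductSpace.rankOne ℂ (x + y) (x + y) - InnerProductSpace.rankOne ℂ (x - y) (x - y)
        + Complex.I • InnerProductSpace.rankOne ℂ (x + Complex.I • y) (x + Complex.I • y)
        - Complex.I • InnerProductSpace.rankOne ℂ (x - Complex.I • y) (x - Complex.I • y)) := by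
    ext z
    simp only [InnerProductSpace.rankOne_apply, smul_apply, add_apply, sub_apply,
      inner_add_left, inner_sub_left, inner_smul_left, Complex.conj_I]
    match_scalars <;> ring_nf <;> simp only [Complex.I_sq] <;> ring
  rw [key]
  refine Submodule.smul_mem _ _ (Submodule.sub_mem _ (Submodule.add_mem _ (Submodule.sub_mem _
    ?_ ?_) (Submodule.smul_mem _ _ ?_)) (Submodule.smul_mem _ _ ?_)) <;>
  exact rankOne_self_mem_traceClass _

/-- The operator `|x⟩⟨y|`, as a trace-class operator. -/
def ketBra {H : Type u} [NormedAddCommGroup H] [InnerProductSpace ℂ H] (x y : H) : traceClass H :=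
  ⟨InnerProductSpace.rankOne ℂ x y, rankOne_mem_traceClass x y⟩

/-- A quantum channel on `H`: a completely positive trace-preserving linear map on the trace-class
operators. Complete positivity says that for every `N` the map `T ↦ (Φ (T i j))` sends positive
`N × N` operator matrices to positive ones. -/
structure QuantumChannel (H : Type u) [NormedAddCommGroup H] [InnerProductSpace ℂ H] where
  /-- the linear map on trace-class operators -/
  map : traceClass H →ₗ[ℂ] traceClass H
  completelyPositive : ∀ (N : ℕ) (T : Fin N → Fin N → traceClass H),
    (∀ v : Fin N → H, ∃ p : ℝ, 0 ≤ p ∧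
      ∑ i, ∑ j, inner ℂ (v i) ((T i j : H →L[ℂ] H) (v j)) = (p : ℂ)) →
    ∀ v : Fin N → H, ∃ p : ℝ, 0 ≤ p ∧
      ∑ i, ∑ j, inner ℂ (v i) ((map (T i j) : H →L[ℂ] H) (v j)) = (p : ℂ)
  tracePreserving : ∀ (T : traceClass H) (t : ℂ),
    HasTrace (T : H →L[ℂ] H) t → HasTrace (map T : H →L[ℂ] H) t

/-! ### One bosonic mode -/

/-- The Hilbert space `ℓ²(ℕ)` of one bosonic mode. -/
abbrev Mode : Type := lp (fun _ : ℕ => ℂ) 2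

/-- The number (Fock) state `|n⟩` of one mode. -/
def numberState (n : ℕ) : Mode := lp.single 2 n (1 : ℂ)

/-- The inclusion of the finite linear combinations of number states in the mode. -/
def finiteToMode : (ℕ →₀ ℂ) →ₗ[ℂ] Mode := Finsupp.linearCombination ℂ numberState

/-- The creation operator `a†|n⟩ = √(n+1) |n+1⟩` on finite combinations of number states. -/
def creationOp : (ℕ →₀ ℂ) →ₗ[ℂ] (ℕ →₀ ℂ) :=
  Finsupp.linearCombination ℂ fun n => Finsupp.single (n + 1) ((√((n : ℝ) + 1) : ℝ) : ℂ)

/-- The annihilation operator `a|n⟩ = √n |n-1⟩`, `a|0⟩ = 0`, on finite combinations of number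
states. -/
def annihilationOp : (ℕ →₀ ℂ) →ₗ[ℂ] (ℕ →₀ ℂ) :=
  Finsupp.linearCombination ℂ fun n => Finsupp.single (n - 1) ((√(n : ℝ) : ℝ) : ℂ)

/-- The generator `ξ a† - ξ* a` of the displacement by `ξ`. -/
def displacementGenerator (ξ : ℂ) : (ℕ →₀ ℂ) →ₗ[ℂ] (ℕ →₀ ℂ) :=
  ξ • creationOp - (starRingEnd ℂ ξ) • annihilationOp

/-- `D(ξ)|n⟩`, where `D(ξ) = exp(ξ a† - ξ* a)` is the displacement operator. The number states are
analytic vectors of the generator, so that the exponential series converges on them in norm. -/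
def displacedNumberState (ξ : ℂ) (n : ℕ) : Mode :=
  ∑' k : ℕ, ((k.factorial : ℂ)⁻¹) •
    finiteToMode ((displacementGenerator ξ ^ k) (Finsupp.single n 1))

/-- The characteristic function `χ_T(ξ) = Tr (T D(ξ))` of a trace-class operator of one mode, the
trace being evaluated in the number basis. -/
def charFunction (T : Mode →L[ℂ] Mode) (ξ : ℂ) : ℂ :=
  ∑' n : ℕ, inner ℂ (numberState n) (T (displacedNumberState ξ n))

/-- `𝒜` is the quantum-limited amplifier channel of gain `G`: it is the channel that acts on the
characteristic functions of states by `χ_out(ξ) = χ_in(√G ξ) exp(-(G-1)|ξ|²/2)`. -/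
def IsQuantumLimitedAmplifier (G : ℝ) (𝒜 : QuantumChannel Mode) : Prop :=
  ∀ T : traceClass Mode, IsDensityOperator (T : Mode →L[ℂ] Mode) → ∀ ξ : ℂ,
    charFunction (𝒜.map T : Mode →L[ℂ] Mode) ξ =
      charFunction (T : Mode →L[ℂ] Mode) (((√G : ℝ) : ℂ) * ξ) *
        ((Real.exp (-(G - 1) * ‖ξ‖ ^ 2 / 2) : ℝ) : ℂ)

/-! ### An ancilla and `M` signal modes -/

/-- The joint Hilbert space `A ⊗ S` of an ancilla `A` and `M` modes `S`, realized as the space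
`ℓ²(ℕ^M; A)` of the square-summable families of vectors of `A` indexed by the multimode number
states: the family `v` stands for `∑ n, v n ⊗ |n⟩`. -/
abbrev JointSpace (A : Type u) [NormedAddCommGroup A] (M : ℕ) : Type u :=
  lp (fun _ : Fin M → ℕ => A) 2

/-- The product vector `a ⊗ |n⟩`, for `a` in `A` and the multimode number state
`|n⟩ = |n₁⟩ ⋯ |n_M⟩`. -/
def tensorNumber {A : Type u} [NormedAddCommGroup A] {M : ℕ} (a : A) (n : Fin M → ℕ) :
    JointSpace A M :=
  lp.single 2 n a

/-- The number-diagonal-signal state `∑ n, √(p n) χ n ⊗ |n⟩`. -/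
def ndsState {A : Type u} [NormedAddCommGroup A] [InnerProductSpace ℂ A] {M : ℕ}
    (p : (Fin M → ℕ) → ℝ) (χ : (Fin M → ℕ) → A) : JointSpace A M :=
  ∑' n, ((√(p n) : ℝ) : ℂ) • tensorNumber (χ n) n

/-- The matrix element `⟨k| Φ(|n⟩⟨n'|) |k'⟩` of a channel of one mode. -/
def channelElement (Φ : QuantumChannel Mode) (k k' n n' : ℕ) : ℂ :=
  inner ℂ (numberState k)
    ((Φ.map (ketBra (numberState n) (numberState n')) : Mode →L[ℂ] Mode) (numberState k'))

/-- `ρ = (id_A ⊗ Φ^{⊗M})(σ)`. Writing `σ = ∑ n n', σ_{nn'} ⊗ |n⟩⟨n'|` with operators `σ_{nn'}` on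
the ancilla, this is `ρ = ∑ n n', σ_{nn'} ⊗ Φ(|n₁⟩⟨n'₁|) ⊗ ⋯ ⊗ Φ(|n_M⟩⟨n'_M|)`, expressed through
the matrix elements between the vectors `a ⊗ |k⟩` and `a' ⊗ |k'⟩`; these determine the bounded
operator `ρ`. The iterated sum converges when `σ` is trace class. -/
def IsProductChannelOutput {A : Type u} [NormedAddCommGroup A] [InnerProductSpace ℂ A] {M : ℕ}
    (Φ : QuantumChannel Mode) (σ ρ : JointSpace A M →L[ℂ] JointSpace A M) : Prop :=
  ∀ (k k' : Fin M → ℕ) (a a' : A),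
    inner ℂ (tensorNumber a k) (ρ (tensorNumber a' k')) =
      ∑' n : Fin M → ℕ, ∑' n' : Fin M → ℕ,
        (∏ m, channelElement Φ (k m) (k' m) (n m) (n' m)) *
          inner ℂ (tensorNumber a n) (σ (tensorNumber a' n'))

end

/-!
The quantum-limited amplifier of gain `G = cosh² τ` emits `j` quanta into its environment with the
amplitudes `a n j = √(C(n+j, j)) (tanh τ)^j (sech τ)^(n+1)`, that is,
`𝒜(|n⟩⟨n'|) = ∑ j, a n j * a n' j |n+j⟩⟨n'+j|`. A number-diagonal-signal state is therefore turned
into the mixture `ρ = ∑ j, |φ j⟩⟨φ j|` of the branches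
`φ j = ∑ n, √(r n) (∏ m, a (n m) (j m)) χ n ⊗ |n+j⟩`. Since the `χ n` are orthonormal, branches with
different `j` are orthogonal, both within one output state and between the two, so that
`⟪φ i, φ' j⟫ = δ_{ij} c j` with `c j ≥ 0`. Then `√ρ φ' j` is `c j` times the normalized `φ j`,
`√ρ ρ' √ρ` is diagonal in the normalized `φ j` with eigenvalues `(c j)²`, and the fidelity is
`∑ j, c j` (`hasFidelity_frameOp`). Summing first over `j`, by the negative binomial series
(`hasSum_multiAmplitude_mul`), gives the powers of `ν`.

The amplitudes have to be derived from the action of the channel on characteristic functions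
(`IsQuantumLimitedAmplifier.channelElement_eq`), for which it must be shown that the characteristic
function determines a trace-class operator `T`. The displaced number states are orthonormal because
the generator of the displacement is antisymmetric, so the trace defining `χ_T(ξ)` converges
absolutely, uniformly in `ξ` (`exists_sum_norm_inner_le_of_mem_traceClass`). The matrix elements of
the displacement are Gaussians times complex Hermite polynomials (`displacedNumberState_apply`): the
explicit expression solves the differential equation in `t` satisfied by `D(tξ)`, and its Taylor
series is the exponential series. Averaging over the phase of `ξ` isolates a diagonal of `T`
(`hasSum_diagonal_of_charFunction`). On a diagonal, the Laplace transform in `|ξ|²` of the radial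
matrix elements is, up to constants, `(1 - 1/s)^n / s^(d+1)`; thus the relation between the two
characteristic functions becomes an identity of power series in `w = 1 - 1/s`, whose coefficients
are compared.
-/

noncomputable section

open InnerProductSpace Filter Topology MeasureTheory
open scoped InnerProductSpace

/-! ### Interchange of nonnegative sums -/

theorem hasSum_comm_of_nonneg {α β : Type*} {f : α → β → ℝ} (hf : ∀ a b, 0 ≤ f a b)
    {g : α → ℝ} {h : β → ℝ} {S : ℝ} (hg : ∀ a, HasSum (f a) (g a)) (hS : HasSum g S)
    (hh : ∀ b, HasSum (fun a => f a b) (h b)) : HasSum h S := by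
  have hsum : Summable (fun x : α × β => f x.1 x.2) := by
    rw [summable_prod_of_nonneg (fun x => hf x.1 x.2)]
    exact ⟨fun a => (hg a).summable, by simpa only [(hg _).tsum_eq] using hS.summable⟩
  have hT : HasSum (fun x : α × β => f x.1 x.2) S := by
    have h1 := hsum.hasSum
    rwa [(h1.prod_fiberwise fun a => hg a).unique hS] at h1
  have hswap : HasSum (fun x : β × α => f x.2 x.1) S :=
    (Equiv.prodComm β α).hasSum_iff (f := fun x : α × β => f x.1 x.2) |>.mpr hT
  exact hswap.prod_fiberwise fun b => hh b

/-! ### Positive operators given by frames -/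

section Frame

variable {H : Type u} [NormedAddCommGroup H] [InnerProductSpace ℂ H]

/-- The operator `∑ j, |f j⟩⟨f j|`, meaningful when `∑ j, ‖f j‖²` converges, in which case the
series converges in operator norm. -/
def frameOp {ι : Type*} (f : ι → H) : H →L[ℂ] H :=
  ∑' j, InnerProductSpace.rankOne ℂ (f j) (f j)

theorem HilbertBasis.hasSum_norm_inner_sq {ι : Type*} (b : HilbertBasis ι ℂ H) (x : H) :
    HasSum (fun i => ‖⟪x, b i⟫_ℂ‖ ^ 2) (‖x‖ ^ 2) := by
  have h := b.hasSum_inner_mul_inner x x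
  rw [inner_self_eq_norm_sq_to_K] at h
  have h2 : HasSum (fun i => ((‖⟪x, b i⟫_ℂ‖ ^ 2 : ℝ) : ℂ)) ((‖x‖ ^ 2 : ℝ) : ℂ) := by
    push_cast
    refine h.congr_fun fun i => ?_
    rw [← inner_conj_symm (b i) x, Complex.mul_conj, Complex.normSq_eq_norm_sq]
    push_cast
    rfl
  exact_mod_cast h2

variable [CompleteSpace H]

theorem hasSum_frameOp {ι : Type*} {f : ι → H}
    (hf : Summable fun j => ‖f j‖ ^ 2) :
    HasSum (fun j => InnerProductSpace.rankOne ℂ (f j) (f j)) (frameOp f) := by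
  refine Summable.hasSum (Summable.of_norm ?_)
  simpa [InnerProductSpace.norm_rankOne, ← sq] using hf

theorem hasSum_frameOp_apply {ι : Type*} {f : ι → H}
    (hf : Summable fun j => ‖f j‖ ^ 2) (x : H) : HasSum (fun j => ⟪f j, x⟫_ℂ • f j) (frameOp f x) :=
  (hasSum_frameOp hf).mapL (ContinuousLinearMap.apply ℂ H x)

theorem hasSum_inner_frameOp {ι : Type*} {f : ι → H}
    (hf : Summable fun j => ‖f j‖ ^ 2) (x y : H) :
    HasSum (fun j => ⟪x, f j⟫_ℂ * ⟪f j, y⟫_ℂ) ⟪x, frameOp f y⟫_ℂ := by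
  have h := (hasSum_frameOp_apply hf y).mapL (innerSL ℂ x)
  simpa [inner_smul_right, mul_comm] using h

theorem hasSum_inner_frameOp_self {ι : Type*} {f : ι → H}
    (hf : Summable fun j => ‖f j‖ ^ 2) (x : H) :
    HasSum (fun j => ((‖⟪f j, x⟫_ℂ‖ ^ 2 : ℝ) : ℂ)) ⟪x, frameOp f x⟫_ℂ := by
  refine (hasSum_inner_frameOp hf x x).congr_fun fun j => ?_
  rw [← inner_conj_symm x (f j), mul_comm, Complex.mul_conj, Complex.normSq_eq_norm_sq]

theorem isPositive_frameOp {ι : Type*} {f : ι → H}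
    (hf : Summable fun j => ‖f j‖ ^ 2) :
    (frameOp f).IsPositive := by
  rw [ContinuousLinearMap.isPositive_iff_complex]
  intro x
  have h := hasSum_inner_frameOp_self hf x
  have h0 : ⟪x, frameOp f x⟫_ℂ = ((∑' j, ‖⟪f j, x⟫_ℂ‖ ^ 2 : ℝ) : ℂ) := by
    rw [← h.tsum_eq, Complex.ofReal_tsum]
  have h1 : ⟪frameOp f x, x⟫_ℂ = ((∑' j, ‖⟪f j, x⟫_ℂ‖ ^ 2 : ℝ) : ℂ) := by
    rw [← inner_conj_symm, h0, Complex.conj_ofReal]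
  rw [h1]
  exact ⟨by simp, by simpa using tsum_nonneg fun j => sq_nonneg _⟩

theorem hasTrace_frameOp {ι : Type*} {f : ι → H}
    (hf : Summable fun j => ‖f j‖ ^ 2) {t : ℝ} (ht : HasSum (fun j => ‖f j‖ ^ 2) t) :
    HasTrace (frameOp f) (t : ℂ) := by
  intro κ b
  have key : HasSum (fun i => ∑' j, ‖⟪f j, b i⟫_ℂ‖ ^ 2) t := by
    refine hasSum_comm_of_nonneg (f := fun j i => ‖⟪f j, b i⟫_ℂ‖ ^ 2) (fun _ _ => sq_nonneg _)
      (fun j => b.hasSum_norm_inner_sq (f j)) ht fun i => Summable.hasSum ?_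
    have := (hasSum_inner_frameOp_self hf (b i)).summable
    exact_mod_cast this
  have h2 := Complex.hasSum_ofReal.mpr key
  refine h2.congr_fun fun i => ?_
  rw [← (hasSum_inner_frameOp_self hf (b i)).tsum_eq, Complex.ofReal_tsum]

theorem mul_frameOp_mul {ι : Type*} {f : ι → H}
    (hf : Summable fun j => ‖f j‖ ^ 2) {S : H →L[ℂ] H} (hS : S.IsPositive) :
    S * frameOp f * S = frameOp fun j => S (f j) := by
  have hsum : Summable fun j => ‖S (f j)‖ ^ 2 := by
    refine (hf.mul_left (‖S‖ ^ 2)).of_nonneg_of_le (fun _ => sq_nonneg _) fun j => ?_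
    rw [← mul_pow]
    exact pow_le_pow_left₀ (norm_nonneg _) (S.le_opNorm _) 2
  ext x
  have h1 := (hasSum_frameOp_apply hf (S x)).mapL S
  refine h1.unique ((hasSum_frameOp_apply hsum x).congr_fun fun j => ?_)
  rw [map_smul, hS.inner_left_eq_inner_right]

/-! ### Positive square roots -/

theorem isPositive_sqrt (T : H →L[ℂ] H) : (CFC.sqrt T).IsPositive :=
  (ContinuousLinearMap.nonneg_iff_isPositive _).mp (CFC.sqrt_nonneg T)

theorem ContinuousLinearMap.IsPositive.sqrt_sqrt_apply {T : H →L[ℂ] H} (hT : T.IsPositive)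
    (x : H) : CFC.sqrt T (CFC.sqrt T x) = T x := by
  have h := CFC.sqrt_mul_sqrt_self T ((ContinuousLinearMap.nonneg_iff_isPositive _).mpr hT)
  exact DFunLike.congr_fun h x

theorem ContinuousLinearMap.IsPositive.inner_eq_inner_sqrt {T : H →L[ℂ] H} (hT : T.IsPositive)
    (x y : H) : ⟪x, T y⟫_ℂ = ⟪CFC.sqrt T x, CFC.sqrt T y⟫_ℂ := by
  rw [(isPositive_sqrt T).inner_left_eq_inner_right, hT.sqrt_sqrt_apply]

theorem ContinuousLinearMap.IsPositive.sqrt_apply_of_apply_eq_zero {T : H →L[ℂ] H}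
    (hT : T.IsPositive) {x : H} (hx : T x = 0) : CFC.sqrt T x = 0 := by
  have h := hT.inner_eq_inner_sqrt x x
  rw [hx, inner_zero_right] at h
  exact inner_self_eq_zero.mp h.symm

/-- Eigenvectors of a positive operator are eigenvectors of its square root: for `μ > 0` the vector
`y = √T x - μ x` satisfies `√T y = -μ y`, hence vanishes by positivity of `√T`. -/
theorem ContinuousLinearMap.IsPositive.sqrt_apply_of_apply_eq_smul {T : H →L[ℂ] H}
    (hT : T.IsPositive) {x : H} {μ : ℝ} (hμ : 0 ≤ μ) (hx : T x = ((μ ^ 2 : ℝ) : ℂ) • x) :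
    CFC.sqrt T x = (μ : ℂ) • x := by
  rcases hμ.eq_or_lt with rfl | hpos
  · simpa using hT.sqrt_apply_of_apply_eq_zero (by simpa using hx)
  set y := CFC.sqrt T x - (μ : ℂ) • x with hy
  have h1 : CFC.sqrt T y = -((μ : ℂ) • y) := by
    rw [hy, map_sub, map_smul, hT.sqrt_sqrt_apply, hx, smul_sub, smul_smul]
    push_cast
    rw [sq]
    abel
  have h2 : 0 ≤ RCLike.re ⟪CFC.sqrt T y, y⟫_ℂ := (isPositive_sqrt T).re_inner_nonneg_left y
  rw [h1, inner_neg_left, inner_smul_left, Complex.conj_ofReal, inner_self_eq_norm_sq_to_K] at h2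
  have h3 : 0 ≤ -(μ * ‖y‖ ^ 2) := by
    have : (-((μ : ℂ) * ((‖y‖ : ℝ) : ℂ) ^ 2)) = ((-(μ * ‖y‖ ^ 2) : ℝ) : ℂ) := by push_cast; ring
    rw [← Complex.ofReal_re (-(μ * ‖y‖ ^ 2)), ← this]
    exact h2
  have h4 : ‖y‖ = 0 := by
    by_contra hne
    have : 0 < ‖y‖ := lt_of_le_of_ne (norm_nonneg _) (Ne.symm hne)
    have : 0 < μ * ‖y‖ ^ 2 := by positivity
    linarith
  exact sub_eq_zero.mp (norm_eq_zero.mp h4)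

/-! ### Fidelity of mixtures with diagonal overlaps -/

/-- If two families of vectors satisfy `⟪φ i, φ j⟫ = 0` for `i ≠ j` and `⟪φ i, φ' j⟫ = δ_{ij} c j`
with `c j ≥ 0`, then the fidelity of `∑ j, |φ j⟩⟨φ j|` and `∑ j, |φ' j⟩⟨φ' j|` is `∑ j, c j`. The
reason is that `√ρ φ' j = c j e j` with `e j = φ j / ‖φ j‖`, so that `√ρ ρ' √ρ` is
`∑ j, (c j)² |e j⟩⟨e j|`. -/
theorem hasFidelity_frameOp {ι : Type*} {φ φ' : ι → H} {c : ι → ℝ} {F : ℝ}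
    (hφ : Summable fun j => ‖φ j‖ ^ 2) (hφ' : Summable fun j => ‖φ' j‖ ^ 2)
    (horth : ∀ i j, i ≠ j → ⟪φ i, φ j⟫_ℂ = 0)
    (hdiag : ∀ j, ⟪φ j, φ' j⟫_ℂ = c j) (hoff : ∀ i j, i ≠ j → ⟪φ i, φ' j⟫_ℂ = 0)
    (hc : ∀ j, 0 ≤ c j) (hF : HasSum c F) :
    HasFidelity (frameOp φ) (frameOp φ') F := by
  have hpos := isPositive_frameOp hφ
  -- If `φ j = 0`, the conventions `0⁻¹ = 0` give `e j = 0`, and `c j = 0`.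
  let e : ι → H := fun j => ((‖φ j‖⁻¹ : ℝ) : ℂ) • φ j
  have hc0 : ∀ j, φ j = 0 → c j = 0 := fun j hj => by
    have := hdiag j
    rw [hj, inner_zero_left] at this
    exact_mod_cast this.symm
  have he_orth : ∀ i j, i ≠ j → ⟪e i, e j⟫_ℂ = 0 := fun i j hij => by
    change ⟪((‖φ i‖⁻¹ : ℝ) : ℂ) • φ i, ((‖φ j‖⁻¹ : ℝ) : ℂ) • φ j⟫_ℂ = 0
    rw [inner_smul_left, inner_smul_right, horth i j hij, mul_zero, mul_zero]
  have he_self : ∀ j, ⟪e j, e j⟫_ℂ • e j = e j := fun j => by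
    by_cases hj : φ j = 0
    · simp [e, hj]
    · have h1 : ‖e j‖ = 1 := by
        simp only [e, norm_smul, Complex.norm_real, norm_inv, norm_norm]
        exact inv_mul_cancel₀ (by simpa using hj)
      rw [inner_self_eq_norm_sq_to_K, h1]
      simp
  -- `φ j` is an eigenvector of `ρ`, because the branches are orthogonal.
  have hsqrt_self : ∀ j, CFC.sqrt (frameOp φ) (φ j) = (‖φ j‖ : ℂ) • φ j := fun j => by
    refine hpos.sqrt_apply_of_apply_eq_smul (norm_nonneg _) ?_
    refine (hasSum_frameOp_apply hφ (φ j)).unique ?_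
    convert hasSum_single j _ using 1
    · rw [inner_self_eq_norm_sq_to_K]; push_cast; rfl
    · intro i hi
      rw [horth i j hi, zero_smul]
  have hsqrt : ∀ j, CFC.sqrt (frameOp φ) (φ' j) = (c j : ℂ) • e j := fun j => by
    -- The difference of `φ' j` and its projection to `φ j` is in the kernel of `ρ`.
    set y := φ' j - ((c j * (‖φ j‖⁻¹) ^ 2 : ℝ) : ℂ) • φ j with hy
    have hy0 : frameOp φ y = 0 := by
      refine (hasSum_frameOp_apply hφ y).unique ?_
      refine hasSum_zero.congr_fun fun i => ?_
      suffices ⟪φ i, y⟫_ℂ = 0 by rw [this, zero_smul]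
      rw [hy, inner_sub_right, inner_smul_right]
      by_cases hij : i = j
      · subst hij
        rw [hdiag, inner_self_eq_norm_sq_to_K]
        by_cases hi : φ i = 0
        · simp [hi, hc0 i hi]
        · have hn : (‖φ i‖ : ℂ) ≠ 0 := by simpa using hi
          push_cast
          change (c i : ℂ) - c i * (‖φ i‖ : ℂ)⁻¹ ^ 2 * (‖φ i‖ : ℂ) ^ 2 = 0
          field_simp
          ring
      · rw [hoff i j hij, horth i j hij, mul_zero, sub_zero]
    have h1 := hpos.sqrt_apply_of_apply_eq_zero hy0
    rw [hy, map_sub, map_smul, hsqrt_self, sub_eq_zero] at h1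
    rw [h1, smul_smul, smul_smul]
    by_cases hj : φ j = 0
    · simp [hj]
    · have hn : (‖φ j‖ : ℂ) ≠ 0 := by simpa using hj
      congr 1
      push_cast
      field_simp
  have hQ := mul_frameOp_mul hφ' (isPositive_sqrt (frameOp φ))
  simp only [hsqrt] at hQ
  have hQsum : Summable fun j => ‖(c j : ℂ) • e j‖ ^ 2 := by
    refine (hφ'.mul_left (‖CFC.sqrt (frameOp φ)‖ ^ 2)).of_nonneg_of_le
      (fun _ => sq_nonneg _) fun j => ?_
    rw [← hsqrt, ← mul_pow]
    exact pow_le_pow_left₀ (norm_nonneg _) (ContinuousLinearMap.le_opNorm _ _) 2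
  let g : ι → H := fun j => ((√(c j) : ℝ) : ℂ) • e j
  have hg_norm : ∀ j, ‖g j‖ ^ 2 = c j := fun j => by
    by_cases hj : φ j = 0
    · simp [g, e, hj, hc0 j hj]
    · have hn : ‖φ j‖ ≠ 0 := by simpa using hj
      simp only [g, e, norm_smul, Complex.norm_real, norm_inv, norm_norm]
      rw [inv_mul_cancel₀ hn, mul_one, Real.norm_eq_abs, sq_abs, Real.sq_sqrt (hc j)]
  have hg : HasSum (fun j => ‖g j‖ ^ 2) F := by simpa only [hg_norm] using hF
  have hg_apply : ∀ j x, ⟪g j, x⟫_ℂ • g j = ((c j : ℂ) * ⟪e j, x⟫_ℂ) • e j := fun j x => by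
    simp only [g, inner_smul_left, smul_smul, Complex.conj_ofReal]
    congr 1
    rw [mul_right_comm, ← Complex.ofReal_mul, Real.mul_self_sqrt (hc j)]
  have hgpos := isPositive_frameOp hg.summable
  have hg_e : ∀ j, frameOp g (e j) = (c j : ℂ) • e j := fun j => by
    refine (hasSum_frameOp_apply hg.summable (e j)).unique ?_
    simp only [hg_apply]
    convert hasSum_single j _ using 1
    · rw [mul_smul, he_self]
    · intro i hi
      rw [he_orth i j hi, mul_zero, zero_smul]
  have hRR : frameOp g * frameOp g = frameOp fun j => (c j : ℂ) • e j := by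
    ext x
    refine (hasSum_frameOp_apply hg.summable (frameOp g x)).unique ?_
    refine (hasSum_frameOp_apply hQsum x).congr_fun fun j => ?_
    rw [hg_apply, ← hgpos.inner_left_eq_inner_right, hg_e, inner_smul_left,
      Complex.conj_ofReal, mul_comm, mul_smul]
  have hfinal :
      CFC.sqrt (CFC.sqrt (frameOp φ) * frameOp φ' * CFC.sqrt (frameOp φ)) = frameOp g := by
    rw [hQ]
    exact CFC.sqrt_unique hRR ((ContinuousLinearMap.nonneg_iff_isPositive _).mpr hgpos)
  unfold HasFidelity
  rw [hfinal]
  exact hasTrace_frameOp hg.summable hg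

end Frame

/-! ### Amplification amplitudes -/

/-- The amplitude `√(C(n+j, j)) (tanh τ)^j (sech τ)^(n+1)`, `G = cosh² τ`, with which an amplifier
of gain `G` turns `|n⟩` into `|n+j⟩` while emitting `j` quanta into its environment. -/
def amplitude (G : ℝ) (n j : ℕ) : ℝ :=
  √((n + j).choose j : ℝ) * √((G - 1) / G) ^ j * (√G)⁻¹ ^ (n + 1)

theorem amplitude_nonneg (G : ℝ) (n j : ℕ) : 0 ≤ amplitude G n j := by
  unfold amplitude; positivity

theorem one_le_sqrt_mul_sub_sqrt_mul {G G' : ℝ} (hG : 1 ≤ G) (hG' : 1 ≤ G') :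
    1 ≤ √(G * G') - √((G - 1) * (G' - 1)) := by
  have h0 : 0 ≤ (G - 1) * (G' - 1) := mul_nonneg (by linarith) (by linarith)
  have hs := Real.sq_sqrt h0
  have hs0 := Real.sqrt_nonneg ((G - 1) * (G' - 1))
  suffices 1 + √((G - 1) * (G' - 1)) ≤ √(G * G') by linarith
  refine Real.le_sqrt_of_sq_le ?_
  have hag : √((G - 1) * (G' - 1)) ≤ ((G - 1) + (G' - 1)) / 2 := by
    rw [Real.sqrt_le_left (by linarith)]
    nlinarith [sq_nonneg (G - G')]
  nlinarith

theorem hasSum_amplitude_mul_amplitude {G G' : ℝ} (hG : 1 ≤ G) (hG' : 1 ≤ G') (n : ℕ) :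
    HasSum (fun j => amplitude G n j * amplitude G' n j)
      ((√(G * G') - √((G - 1) * (G' - 1)))⁻¹ ^ (n + 1)) := by
  have hν := one_le_sqrt_mul_sub_sqrt_mul hG hG'
  have hG0 : 0 < G := by linarith
  have hG0' : 0 < G' := by linarith
  have hs : 0 < √G := Real.sqrt_pos.mpr hG0
  have hs' : 0 < √G' := Real.sqrt_pos.mpr hG0'
  rw [Real.sqrt_mul hG0.le, Real.sqrt_mul (by linarith : 0 ≤ G - 1)] at hν ⊢
  set q : ℝ := √((G - 1) / G) * √((G' - 1) / G') with hq
  have hq' : q * (√G * √G') = √(G - 1) * √(G' - 1) := by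
    rw [hq, Real.sqrt_div (by linarith), Real.sqrt_div (by linarith)]
    field_simp
  have hq0 : 0 ≤ q := by positivity
  have hq1 : q < 1 := by
    by_contra! hcon
    have : √G * √G' ≤ q * (√G * √G') := le_mul_of_one_le_left (by positivity) hcon
    linarith
  have h := (hasSum_choose_mul_geometric_of_norm_lt_one n
    (by rwa [Real.norm_of_nonneg hq0] : ‖q‖ < 1)).mul_right ((√G)⁻¹ * (√G')⁻¹) |>.mul_right
      (((√G)⁻¹ * (√G')⁻¹) ^ n)
  have hval : 1 / (1 - q) ^ (n + 1) * ((√G)⁻¹ * (√G')⁻¹) * ((√G)⁻¹ * (√G')⁻¹) ^ n =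
      (√G * √G' - √(G - 1) * √(G' - 1))⁻¹ ^ (n + 1) := by
    rw [← hq']
    have : √G * √G' - q * (√G * √G') = (1 - q) * (√G * √G') := by ring
    rw [this, mul_inv, mul_inv, one_div, ← inv_pow, mul_pow (1 - q)⁻¹, mul_assoc,
      ← pow_succ']
  rw [hval] at h
  refine h.congr_fun fun j => ?_
  have hch : √((n + j).choose j : ℝ) * √((n + j).choose j : ℝ) = ((j + n).choose n : ℝ) := by
    rw [Real.mul_self_sqrt (by positivity), ← Nat.choose_symm_add, add_comm]
  rw [← hch, hq]
  unfold amplitude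
  ring

theorem hasSum_prod_pi {M : ℕ} {f : Fin M → ℕ → ℝ} {S : Fin M → ℝ} (hf : ∀ m j, 0 ≤ f m j)
    (h : ∀ m, HasSum (f m) (S m)) : HasSum (fun j : Fin M → ℕ => ∏ m, f m (j m)) (∏ m, S m) := by
  induction M with
  | zero => exact hasSum_unique (fun j : Fin 0 → ℕ => ∏ m, f m (j m))
  | succ M ih =>
    have h1 : HasSum (fun j : Fin M → ℕ => ∏ m : Fin M, f m.succ (j m)) (∏ m : Fin M, S m.succ) :=
      ih (fun _ _ => hf _ _) fun m => h _
    have hs : Summable fun x : ℕ × (Fin M → ℕ) => f 0 x.1 * ∏ m : Fin M, f m.succ (x.2 m) :=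
      Summable.mul_of_nonneg (f := f 0) (g := fun j : Fin M → ℕ => ∏ m : Fin M, f m.succ (j m))
        (h 0).summable h1.summable (fun j => hf 0 j)
        fun j => Finset.prod_nonneg fun m _ => hf m.succ (j m)
    have h2 := (h 0).mul h1 hs
    refine ((Fin.consEquiv fun _ : Fin (M + 1) => ℕ).hasSum_iff
      (f := fun j : Fin (M + 1) → ℕ => ∏ m, f m (j m))).mp ?_
    rw [Fin.prod_univ_succ]
    refine h2.congr_fun fun x => ?_
    simp [Fin.prod_univ_succ, Fin.consEquiv]

/-- The amplitude with which `M` amplifiers of gain `G` turn `|n⟩` into `|n+j⟩`. -/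
def multiAmplitude {M : ℕ} (G : ℝ) (n j : Fin M → ℕ) : ℝ := ∏ m, amplitude G (n m) (j m)

theorem multiAmplitude_nonneg {M : ℕ} (G : ℝ) (n j : Fin M → ℕ) : 0 ≤ multiAmplitude G n j :=
  Finset.prod_nonneg fun _ _ => amplitude_nonneg _ _ _

theorem hasSum_multiAmplitude_mul {M : ℕ} {G G' : ℝ} (hG : 1 ≤ G) (hG' : 1 ≤ G')
    (n : Fin M → ℕ) :
    HasSum (fun j => multiAmplitude G n j * multiAmplitude G' n j)
      ((√(G * G') - √((G - 1) * (G' - 1)))⁻¹ ^ ((∑ m, n m) + M)) := by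
  have h := hasSum_prod_pi (fun m j => mul_nonneg (amplitude_nonneg G (n m) j)
    (amplitude_nonneg G' (n m) j)) fun m => hasSum_amplitude_mul_amplitude hG hG' (n m)
  rw [Finset.prod_pow_eq_pow_sum, Finset.sum_add_distrib] at h
  simpa [multiAmplitude, Finset.prod_mul_distrib] using h

theorem multiAmplitude_le_one {M : ℕ} {G : ℝ} (hG : 1 ≤ G) (n j : Fin M → ℕ) :
    multiAmplitude G n j ≤ 1 := by
  have h := hasSum_multiAmplitude_mul hG hG n
  have h1 := le_hasSum h j fun i _ => mul_self_nonneg _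
  have : √(G * G) - √((G - 1) * (G - 1)) = 1 := by
    rw [Real.sqrt_mul_self (by linarith), Real.sqrt_mul_self (by linarith)]; ring
  rw [this, inv_one, one_pow] at h1
  nlinarith [multiAmplitude_nonneg G n j]

/-! ### Shifted number-diagonal-signal vectors -/

section Joint

variable {A : Type u} [NormedAddCommGroup A] [InnerProductSpace ℂ A] {M : ℕ}

theorem inner_tensorNumber (a : A) (k : Fin M → ℕ) (v : JointSpace A M) :
    ⟪tensorNumber a k, v⟫_ℂ = ⟪a, v k⟫_ℂ :=
  lp.inner_single_left k a v

/-- The vector `∑ n, w n χ n ⊗ |n+j⟩`. -/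
def shiftedState (w : (Fin M → ℕ) → ℝ) (χ : (Fin M → ℕ) → A) (j : Fin M → ℕ) : JointSpace A M :=
  ∑' n, ((w n : ℝ) : ℂ) • tensorNumber (χ n) (n + j)

theorem ndsState_eq_shiftedState (p : (Fin M → ℕ) → ℝ) (χ : (Fin M → ℕ) → A) :
    ndsState p χ = shiftedState (fun n => √(p n)) χ 0 := by
  simp [ndsState, shiftedState]

theorem eq_zero_of_notMem_range_add {α : Type*} [Zero α] {f : (Fin M → ℕ) → α} {j : Fin M → ℕ}
    (hf : ∀ k, ¬ j ≤ k → f k = 0) (k : Fin M → ℕ) (hk : k ∉ Set.range fun n => n + j) :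
    f k = 0 :=
  hf k fun hjk => hk ⟨k - j, tsub_add_cancel_of_le hjk⟩

open scoped Classical in
theorem shiftedState_apply {χ : (Fin M → ℕ) → A} (hχ : Orthonormal ℂ χ)
    {w : (Fin M → ℕ) → ℝ} (hw : Summable fun n => w n ^ 2)
    (j k : Fin M → ℕ) :
    shiftedState w χ j k = if j ≤ k then ((w (k - j) : ℝ) : ℂ) • χ (k - j) else 0 := by
  have hmem : Memℓp (fun k => if j ≤ k then ((w (k - j) : ℝ) : ℂ) • χ (k - j) else 0) 2 := by
    refine memℓp_gen ?_
    rw [← (add_left_injective j).summable_iff]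
    · refine hw.congr fun n => ?_
      simp [norm_smul, hχ.1]
    · refine eq_zero_of_notMem_range_add fun k hk => ?_
      simp [hk]
  have h := lp.hasSum_single (E := fun _ : Fin M → ℕ => A) (p := 2) (by simp) ⟨_, hmem⟩
  rw [← (add_left_injective j).hasSum_iff] at h
  · have h2 : shiftedState w χ j = ⟨_, hmem⟩ := by
      rw [← h.tsum_eq]
      refine tsum_congr fun n => ?_
      simp [tensorNumber, lp.single_smul]
      congr!
    rw [h2]
  · refine eq_zero_of_notMem_range_add fun k hk => ?_
    simp [hk]

theorem hasSum_inner_shiftedState {χ : (Fin M → ℕ) → A} (hχ : Orthonormal ℂ χ)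
    {w w' : (Fin M → ℕ) → ℝ} (hw : Summable fun n => w n ^ 2)
    (hw' : Summable fun n => w' n ^ 2) (j : Fin M → ℕ) :
    HasSum (fun n => ((w n * w' n : ℝ) : ℂ)) ⟪shiftedState w χ j, shiftedState w' χ j⟫_ℂ := by
  have h := lp.hasSum_inner (𝕜 := ℂ) (shiftedState w χ j) (shiftedState w' χ j)
  rw [← (add_left_injective j).hasSum_iff] at h
  · refine h.congr_fun fun n => ?_
    rw [Function.comp_apply, shiftedState_apply hχ hw, shiftedState_apply hχ hw',
      if_pos le_add_self, if_pos le_add_self, add_tsub_cancel_right, inner_smul_left,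
      inner_smul_right, inner_self_eq_norm_sq_to_K, hχ.1]
    simp
  · refine eq_zero_of_notMem_range_add fun k hk => ?_
    simp [shiftedState_apply hχ hw, hk]

theorem inner_shiftedState_of_ne {χ : (Fin M → ℕ) → A} (hχ : Orthonormal ℂ χ)
    {w w' : (Fin M → ℕ) → ℝ} (hw : Summable fun n => w n ^ 2)
    (hw' : Summable fun n => w' n ^ 2) {i j : Fin M → ℕ} (hij : i ≠ j) :
    ⟪shiftedState w χ i, shiftedState w' χ j⟫_ℂ = 0 := by
  refine (lp.hasSum_inner (𝕜 := ℂ) (shiftedState w χ i) (shiftedState w' χ j)).unique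
    (hasSum_zero.congr_fun fun k => ?_)
  rw [shiftedState_apply hχ hw, shiftedState_apply hχ hw']
  split_ifs with h1 h2
  · have hne : k - i ≠ k - j := fun h => hij <| by
      rw [← tsub_tsub_cancel_of_le h1, ← tsub_tsub_cancel_of_le h2, h]
    rw [inner_smul_left, inner_smul_right, hχ.2 hne, mul_zero, mul_zero]
  all_goals simp

/-- The weights of the branch in which the amplifiers have emitted `j` quanta. -/
def branchWeight (G : ℝ) (r : (Fin M → ℕ) → ℝ) (j n : Fin M → ℕ) : ℝ :=
  √(r n) * multiAmplitude G n j

theorem branchWeight_sq_le {G : ℝ} (hG : 1 ≤ G) {r : (Fin M → ℕ) → ℝ} (hr : ∀ n, 0 ≤ r n)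
    (j n : Fin M → ℕ) : branchWeight G r j n ^ 2 ≤ r n := by
  rw [branchWeight, mul_pow, Real.sq_sqrt (hr n)]
  exact mul_le_of_le_one_right (hr n)
    (pow_le_one₀ (multiAmplitude_nonneg _ _ _) (multiAmplitude_le_one hG n j))

end Joint

/-! ### The displacement operators in the number basis -/

theorem finiteToMode_single (n : ℕ) (c : ℂ) :
    finiteToMode (Finsupp.single n c) = c • numberState n := by
  simp [finiteToMode]

theorem inner_numberState (m : ℕ) (v : Mode) : ⟪numberState m, v⟫_ℂ = v m := by
  rw [numberState, lp.inner_single_left]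
  simp

theorem orthonormal_numberState : Orthonormal ℂ numberState := by
  rw [orthonormal_iff_ite]
  intro i j
  rw [inner_numberState]
  simp [numberState, lp.single_apply, Pi.single_apply]

theorem inner_numberState_finiteToMode (m : ℕ) (v : ℕ →₀ ℂ) :
    ⟪numberState m, finiteToMode v⟫_ℂ = v m := by
  induction v using Finsupp.induction_linear with
  | zero => simp
  | add u v hu hv => rw [map_add, inner_add_right, hu, hv, Finsupp.add_apply]
  | single n c =>
    rw [finiteToMode_single, inner_smul_right, orthonormal_iff_ite.mp orthonormal_numberState,
      Finsupp.single_apply]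
    simp [eq_comm]

theorem displacementGenerator_single (ξ : ℂ) (n : ℕ) :
    displacementGenerator ξ (Finsupp.single n 1) =
      (ξ * ((√((n : ℝ) + 1) : ℝ) : ℂ)) • Finsupp.single (n + 1) 1 -
        (starRingEnd ℂ ξ * ((√(n : ℝ) : ℝ) : ℂ)) • Finsupp.single (n - 1) 1 := by
  simp [displacementGenerator, creationOp, annihilationOp]

theorem displacementGenerator_apply (ξ : ℂ) (v : ℕ →₀ ℂ) (m : ℕ) :
    displacementGenerator ξ v m =
      ξ * ((√(m : ℝ) : ℝ) : ℂ) * v (m - 1) -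
        starRingEnd ℂ ξ * ((√((m : ℝ) + 1) : ℝ) : ℂ) * v (m + 1) := by
  induction v using Finsupp.induction_linear with
  | zero => simp
  | add u v hu hv =>
    rw [map_add, Finsupp.add_apply, hu, hv, Finsupp.add_apply, Finsupp.add_apply]
    ring
  | single n c =>
    have hc : Finsupp.single n c = c • Finsupp.single n (1 : ℂ) := by simp
    rw [hc, map_smul, displacementGenerator_single]
    simp only [Finsupp.smul_apply, Finsupp.sub_apply, Finsupp.single_apply, smul_eq_mul]
    rcases m with _ | m
    · rcases n with _ | n
      · simp
      · by_cases h : n = 0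
        · subst h; simp; ring
        · simp [h]
    · rcases n with _ | n
      · by_cases h : m = 0
        · subst h; simp; ring
        · have h1 : ¬ 0 = m := fun h' => h h'.symm
          simp [h1, h]
      · by_cases h : n + 1 = m
        · subst h
          simp [show n ≠ n + 1 + 1 by omega]; ring
        · by_cases h' : n = m + 1
          · subst h'
            simp [show m + 1 + 1 ≠ m by omega]; ring
          · simp [h, h']

/-- By induction on `k`, with `X^(k+1)|n⟩ = X^k (X|n⟩)`: the constant
`(n+1).ascFactorial k = (n+1)⋯(n+k)` absorbs the factors `√(n+1)` and `√n` from `X|n⟩`. -/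
theorem norm_finiteToMode_displacementGenerator_pow_le (ξ : ℂ) (k n : ℕ) :
    ‖finiteToMode ((displacementGenerator ξ ^ k) (Finsupp.single n 1))‖ ≤
      (2 * ‖ξ‖) ^ k * √((n + 1).ascFactorial k : ℝ) := by
  induction k generalizing n with
  | zero => simp [finiteToMode_single, orthonormal_numberState.1]
  | succ k ih =>
    have hle : ∀ l c : ℕ, c * (l + 1).ascFactorial k ≤ (n + 1).ascFactorial (k + 1) →
        √(c : ℝ) * ‖finiteToMode ((displacementGenerator ξ ^ k) (Finsupp.single l 1))‖ ≤
          (2 * ‖ξ‖) ^ k * √((n + 1).ascFactorial (k + 1) : ℝ) := fun l c h => by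
      calc √(c : ℝ) * ‖finiteToMode ((displacementGenerator ξ ^ k) (Finsupp.single l 1))‖
          ≤ √(c : ℝ) * ((2 * ‖ξ‖) ^ k * √((l + 1).ascFactorial k : ℝ)) := by gcongr; exact ih l
        _ = (2 * ‖ξ‖) ^ k * √((c * (l + 1).ascFactorial k : ℕ) : ℝ) := by
          rw [Nat.cast_mul, Real.sqrt_mul (by positivity)]; ring
        _ ≤ _ := by gcongr
    have h1 := hle (n + 1) (n + 1) (by rw [Nat.succ_ascFactorial, Nat.ascFactorial_succ])
    have h2 := hle (n - 1) n (by
      rcases n with _ | n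
      · simp
      · rw [Nat.add_sub_cancel, Nat.ascFactorial_succ]
        exact Nat.mul_le_mul (by omega) (Nat.ascFactorial_le k (by omega)))
    rw [pow_succ, Module.End.mul_apply, displacementGenerator_single, map_sub, map_sub, map_smul,
      map_smul, map_smul, map_smul]
    refine (norm_sub_le _ _).trans ?_
    rw [norm_smul, norm_smul, norm_mul, norm_mul, RCLike.norm_conj, Complex.norm_real,
      Complex.norm_real, Real.norm_of_nonneg (Real.sqrt_nonneg _),
      Real.norm_of_nonneg (Real.sqrt_nonneg _), pow_succ (2 * ‖ξ‖)]
    push_cast at h1 h2 ⊢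
    have := mul_le_mul_of_nonneg_left (add_le_add h1 h2) (norm_nonneg ξ)
    linarith

/-- The terms are at most `√(2^n (8|ξ|²)^k / k!)`, which the inequality between the geometric and
the arithmetic mean bounds by half the sum of `2^n (16|ξ|²)^k / k!` and `2^(-k)`. -/
theorem summable_norm_displacement_series (ξ : ℂ) (n : ℕ) :
    Summable fun k : ℕ => ‖((k.factorial : ℂ)⁻¹) •
      finiteToMode ((displacementGenerator ξ ^ k) (Finsupp.single n 1))‖ := by
  have hs : Summable fun k : ℕ =>
      ((2 : ℝ) ^ n * ((16 * ‖ξ‖ ^ 2) ^ k / k.factorial) + (1 / 2 : ℝ) ^ k) / 2 :=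
    (((Real.summable_pow_div_factorial _).mul_left _).add
      (summable_geometric_of_lt_one (by norm_num) (by norm_num))).div_const 2
  refine hs.of_nonneg_of_le (fun _ => norm_nonneg _) fun k => ?_
  set a : ℝ := (k.factorial : ℝ)⁻¹ * ((2 * ‖ξ‖) ^ k * √((n + 1).ascFactorial k : ℝ)) with ha
  have h1 : ‖((k.factorial : ℂ)⁻¹) •
      finiteToMode ((displacementGenerator ξ ^ k) (Finsupp.single n 1))‖ ≤ a := by
    rw [norm_smul, norm_inv, Complex.norm_natCast, ha]
    gcongr
    exact norm_finiteToMode_displacementGenerator_pow_le ξ k n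
  have hfac : (0 : ℝ) < k.factorial := by exact_mod_cast k.factorial_pos
  have h2 : a ^ 2 ≤ 2 ^ n * ((8 * ‖ξ‖ ^ 2) ^ k / k.factorial) := by
    have hch : ((n + 1).ascFactorial k : ℝ) ≤ k.factorial * 2 ^ (n + k) := by
      rw [Nat.ascFactorial_eq_factorial_mul_choose]
      push_cast
      gcongr
      exact_mod_cast Nat.choose_le_two_pow _ _
    calc a ^ 2 = ((2 * ‖ξ‖) ^ k) ^ 2 * ((n + 1).ascFactorial k : ℝ) / k.factorial ^ 2 := by
          rw [ha, mul_pow, mul_pow, Real.sq_sqrt (by positivity)]; field_simp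
      _ ≤ ((2 * ‖ξ‖) ^ k) ^ 2 * (k.factorial * 2 ^ (n + k)) / k.factorial ^ 2 := by gcongr
      _ = 2 ^ n * ((8 * ‖ξ‖ ^ 2) ^ k / k.factorial) := by
          rw [pow_add, show (8 : ℝ) * ‖ξ‖ ^ 2 = (2 * ‖ξ‖) ^ 2 * 2 by ring, mul_pow _ (2 : ℝ),
            ← pow_mul, ← pow_mul, mul_comm k 2]
          field_simp
  have ht : (0 : ℝ) < 2 ^ k := by positivity
  have h3 : 2 * a ≤ 2 ^ k * a ^ 2 + (1 / 2) ^ k := by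
    have h4 : (1 / 2 : ℝ) ^ k * 2 ^ k = 1 := by rw [← mul_pow]; norm_num
    have h5 : (0 : ℝ) < (1 / 2) ^ k := by positivity
    nlinarith [mul_nonneg h5.le (sq_nonneg (2 ^ k * a - 1))]
  have h6 : 2 ^ k * a ^ 2 ≤ 2 ^ n * ((16 * ‖ξ‖ ^ 2) ^ k / k.factorial) := by
    calc 2 ^ k * a ^ 2 ≤ 2 ^ k * (2 ^ n * ((8 * ‖ξ‖ ^ 2) ^ k / k.factorial)) := by gcongr
      _ = _ := by
        rw [show (16 : ℝ) * ‖ξ‖ ^ 2 = 2 * (8 * ‖ξ‖ ^ 2) by ring, mul_pow 2 (8 * ‖ξ‖ ^ 2)]; ring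
  linarith

theorem hasSum_displacedNumberState (ξ : ℂ) (n : ℕ) :
    HasSum (fun k : ℕ => ((k.factorial : ℂ)⁻¹) •
      finiteToMode ((displacementGenerator ξ ^ k) (Finsupp.single n 1)))
      (displacedNumberState ξ n) :=
  (summable_norm_displacement_series ξ n).of_norm.hasSum

/-! ### Orthonormality of the displaced number states -/

theorem inner_finiteToMode_displacementGenerator (ξ : ℂ) (u v : ℕ →₀ ℂ) :
    ⟪finiteToMode (displacementGenerator ξ u), finiteToMode v⟫_ℂ =
      -⟪finiteToMode u, finiteToMode (displacementGenerator ξ v)⟫_ℂ := by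
  induction u using Finsupp.induction_linear with
  | zero => simp
  | add u u' hu hu' => simp only [map_add, inner_add_left, hu, hu', neg_add]
  | single i a =>
    have ha : Finsupp.single i a = a • Finsupp.single i (1 : ℂ) := by simp
    rw [ha, map_smul, map_smul, map_smul, inner_smul_left, inner_smul_left,
      displacementGenerator_single, map_sub, map_smul, map_smul, inner_sub_left, inner_smul_left,
      inner_smul_left]
    simp only [finiteToMode_single, one_smul, inner_numberState_finiteToMode,
      displacementGenerator_apply, map_mul, Complex.conj_conj, Complex.conj_ofReal]
    ring

theorem inner_displacementGenerator_pow (ξ : ℂ) (k : ℕ) (u v : ℕ →₀ ℂ) :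
    ⟪finiteToMode ((displacementGenerator ξ ^ k) u), finiteToMode v⟫_ℂ =
      (-1) ^ k * ⟪finiteToMode u, finiteToMode ((displacementGenerator ξ ^ k) v)⟫_ℂ := by
  induction k generalizing v with
  | zero => simp
  | succ k ih =>
    rw [pow_succ', Module.End.mul_apply, inner_finiteToMode_displacementGenerator, ih,
      ← Module.End.mul_apply, ← pow_succ, pow_succ' (displacementGenerator ξ)]
    ring

theorem sum_antidiagonal_neg_one_pow_div (N : ℕ) :
    ∑ p ∈ Finset.HasAntidiagonal.antidiagonal N,
        ((p.1.factorial : ℂ)⁻¹ * (p.2.factorial : ℂ)⁻¹ * (-1) ^ p.1) =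
      if N = 0 then 1 else 0 := by
  have h := (Commute.all (-1 : ℂ) 1).add_pow' N
  have hN : (N.factorial : ℂ) ≠ 0 := by exact_mod_cast N.factorial_ne_zero
  have h2 : ∑ p ∈ Finset.HasAntidiagonal.antidiagonal N,
      ((p.1.factorial : ℂ)⁻¹ * (p.2.factorial : ℂ)⁻¹ * (-1) ^ p.1) =
      (N.factorial : ℂ)⁻¹ * (-1 + 1 : ℂ) ^ N := by
    rw [h, Finset.mul_sum]
    refine Finset.sum_congr rfl fun p hp => ?_
    obtain ⟨i, j⟩ := p
    rw [Finset.HasAntidiagonal.mem_antidiagonal] at hp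
    subst hp
    have hi : (i.factorial : ℂ) ≠ 0 := by exact_mod_cast i.factorial_ne_zero
    have hj : (j.factorial : ℂ) ≠ 0 := by exact_mod_cast j.factorial_ne_zero
    have hch : ((i + j).choose i : ℂ) * i.factorial * j.factorial = (i + j).factorial := by
      rw [Nat.choose_symm_add]
      exact_mod_cast Nat.add_choose_mul_factorial_mul_factorial i j
    simp only [one_pow, mul_one, nsmul_eq_mul]
    rw [← hch]
    have hc : ((i + j).choose i : ℂ) ≠ 0 := by
      exact_mod_cast (Nat.choose_pos (Nat.le_add_right i j)).ne'
    field_simp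
  rw [h2]
  split_ifs with h0
  · simp [h0]
  · simp [h0]

/-- Antisymmetry of the generator `X` gives `⟪X^k m, X^l n⟫ = (-1)^k ⟪m, X^(k+l) n⟫`; in the Cauchy
product of the two exponential series the terms with `k + l > 0` cancel. -/
theorem orthonormal_displacedNumberState (ξ : ℂ) : Orthonormal ℂ (displacedNumberState ξ) := by
  rw [orthonormal_iff_ite]
  intro m n
  set x : ℕ → Mode := fun k => ((k.factorial : ℂ)⁻¹) •
      finiteToMode ((displacementGenerator ξ ^ k) (Finsupp.single m 1)) with hx
  set y : ℕ → Mode := fun k => ((k.factorial : ℂ)⁻¹) •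
      finiteToMode ((displacementGenerator ξ ^ k) (Finsupp.single n 1)) with hy
  have hxy : ∀ k l, ⟪x k, y l⟫_ℂ = ((k.factorial : ℂ)⁻¹ * (l.factorial : ℂ)⁻¹ * (-1) ^ k) *
      ((displacementGenerator ξ ^ (k + l)) (Finsupp.single n 1)) m := fun k l => by
    simp only [hx, hy, inner_smul_left, inner_smul_right, inner_displacementGenerator_pow]
    rw [← Module.End.mul_apply, ← pow_add, finiteToMode_single, one_smul,
      inner_numberState_finiteToMode, map_inv₀, Complex.conj_natCast]
    ring
  have hsum : Summable fun p : ℕ × ℕ => ⟪x p.1, y p.2⟫_ℂ := by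
    refine Summable.of_norm_bounded ((summable_norm_displacement_series ξ m).mul_of_nonneg
      (summable_norm_displacement_series ξ n) (fun _ => norm_nonneg _) fun _ => norm_nonneg _)
      fun p => norm_inner_le_norm _ _
  have h1 : ∑' p : ℕ × ℕ, ⟪x p.1, y p.2⟫_ℂ =
      ⟪displacedNumberState ξ m, displacedNumberState ξ n⟫_ℂ := by
    have hrow : ∀ k, HasSum (fun l => ⟪x k, y l⟫_ℂ) ⟪x k, displacedNumberState ξ n⟫_ℂ :=
      fun k => (hasSum_displacedNumberState ξ n).mapL (innerSL ℂ (x k))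
    have hcol : HasSum (fun k => ⟪x k, displacedNumberState ξ n⟫_ℂ)
        ⟪displacedNumberState ξ m, displacedNumberState ξ n⟫_ℂ := by
      have := (hasSum_displacedNumberState ξ m).mapL (innerSL ℂ (displacedNumberState ξ n))
      have h2 := Complex.hasSum_conj'.mpr this
      simpa only [innerSL_apply_apply, inner_conj_symm] using h2
    exact (hsum.hasSum.prod_fiberwise hrow).unique hcol
  have h2 : HasSum (fun N => ∑ p ∈ Finset.HasAntidiagonal.antidiagonal N, ⟪x p.1, y p.2⟫_ℂ)
      (∑' p : ℕ × ℕ, ⟪x p.1, y p.2⟫_ℂ) := by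
    have h3 :=
      (Finset.HasAntidiagonal.sigmaAntidiagonalEquivProd (A := ℕ)).hasSum_iff.mpr hsum.hasSum
    refine (h3.sigma fun N => hasSum_fintype _).congr_fun fun N => ?_
    rw [← Finset.sum_coe_sort]
    rfl
  rw [← h1]
  refine h2.unique ?_
  convert hasSum_single
    (f := fun N => ∑ p ∈ Finset.HasAntidiagonal.antidiagonal N, ⟪x p.1, y p.2⟫_ℂ) 0 ?_ using 1
  · simp [hxy, Finsupp.single_apply, eq_comm]
  · intro N hN
    have : ∀ p ∈ Finset.HasAntidiagonal.antidiagonal N, ⟪x p.1, y p.2⟫_ℂ =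
        ((p.1.factorial : ℂ)⁻¹ * (p.2.factorial : ℂ)⁻¹ * (-1) ^ p.1) *
          ((displacementGenerator ξ ^ N) (Finsupp.single n 1)) m := fun p hp => by
      rw [hxy, Finset.HasAntidiagonal.mem_antidiagonal.mp hp]
    rw [Finset.sum_congr rfl this, ← Finset.sum_mul, sum_antidiagonal_neg_one_pow_div, if_neg hN,
      zero_mul]

/-! ### Matrix elements of the displacement operators -/

/-- The complex Hermite (Itô) polynomial `(z + ∂/∂y)^n y^m`. -/
def complexHermite : ℕ → ℕ → ℂ → ℂ → ℂ
  | m, 0, y, _ => y ^ m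
  | m, n + 1, y, z => z * complexHermite m n y z + m * complexHermite (m - 1) n y z

theorem complexHermite_succ_right (m n : ℕ) (y z : ℂ) :
    complexHermite m (n + 1) y z =
      z * complexHermite m n y z + m * complexHermite (m - 1) n y z := rfl

theorem complexHermite_succ_left (m n : ℕ) (y z : ℂ) :
    complexHermite (m + 1) n y z =
      y * complexHermite m n y z + n * complexHermite m (n - 1) y z := by
  induction n generalizing m with
  | zero => simp [complexHermite, pow_succ']
  | succ n ih =>
    have h1 : (m : ℂ) * complexHermite m n y z =
        m * (y * complexHermite (m - 1) n y z + n * complexHermite (m - 1) (n - 1) y z) := by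
      rcases m with _ | m
      · simp
      · rw [ih m, Nat.add_sub_cancel]
    have h2 : (n : ℂ) * complexHermite m n y z =
        n * (z * complexHermite m (n - 1) y z + m * complexHermite (m - 1) (n - 1) y z) := by
      rcases n with _ | n
      · simp
      · rw [Nat.add_sub_cancel, complexHermite_succ_right]
    rw [complexHermite_succ_right (m + 1), ih, Nat.add_sub_cancel, Nat.add_sub_cancel,
      complexHermite_succ_right m]
    push_cast
    linear_combination h1 - h2

theorem complexHermite_zero_left (n : ℕ) (y z : ℂ) : complexHermite 0 n y z = z ^ n := by
  induction n with
  | zero => simp [complexHermite]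
  | succ n ih => rw [complexHermite_succ_right, ih]; simp [pow_succ']

theorem complexHermite_symm (m n : ℕ) (y z : ℂ) :
    complexHermite m n y z = complexHermite n m z y := by
  induction m generalizing n with
  | zero => rw [complexHermite_zero_left]; rfl
  | succ m ih => rw [complexHermite_succ_left, complexHermite_succ_right, ih, ih]

/-- Rotation covariance of the complex Hermite polynomials. -/
theorem complexHermite_smul (m n : ℕ) (a b y z : ℂ) (hab : a * b = 1) :
    complexHermite m n (a * y) (b * z) = a ^ m * b ^ n * complexHermite m n y z := by
  induction n generalizing m with
  | zero => simp [complexHermite, mul_pow]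
  | succ n ih =>
    rw [complexHermite_succ_right, ih, ih, complexHermite_succ_right]
    rcases m with _ | m
    · simp; ring
    · rw [Nat.add_sub_cancel, pow_succ b, pow_succ a]
      linear_combination (-(((m + 1 : ℕ) : ℂ) * a ^ m * b ^ n * complexHermite m n y z)) * hab

theorem complexHermite_zero_zero (m n : ℕ) :
    complexHermite m n 0 0 = if m = n then (n.factorial : ℂ) else 0 := by
  induction n generalizing m with
  | zero => simp [complexHermite, zero_pow_eq]
  | succ n ih =>
    rw [complexHermite_succ_right, ih, ih]
    rcases m with _ | m
    · simp
    · by_cases h : m = n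
      · subst h; simp [Nat.factorial_succ]
      · simp [h]

theorem hasDerivAt_complexHermite (m n : ℕ) (ξ η t : ℂ) :
    HasDerivAt (fun t => complexHermite m n (t * ξ) (t * η))
      (ξ * m * complexHermite (m - 1) n (t * ξ) (t * η) +
        η * n * complexHermite m (n - 1) (t * ξ) (t * η)) t := by
  induction n generalizing m with
  | zero =>
    have h := ((hasDerivAt_id t).mul_const ξ).pow m
    refine HasDerivAt.congr_deriv (f' := _) h ?_
    simp [complexHermite]
    ring
  | succ n ih =>
    have h := (((hasDerivAt_id t).mul_const η).mul (ih m)).add ((ih (m - 1)).const_mul (m : ℂ))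
    refine h.congr_deriv ?_
    have h2 : (n : ℂ) * complexHermite m n (t * ξ) (t * η) =
        n * (t * η * complexHermite m (n - 1) (t * ξ) (t * η) +
          m * complexHermite (m - 1) (n - 1) (t * ξ) (t * η)) := by
      rcases n with _ | n
      · simp
      · rw [Nat.add_sub_cancel, complexHermite_succ_right]
    rw [Nat.add_sub_cancel, complexHermite_succ_right (m - 1)]
    simp only [id]
    push_cast
    linear_combination (-η) * h2

/-- The closed form `exp(-t²|ξ|²/2) H_{mn}(tξ, -tξ*) / √(m! n!)` of the matrix element
`⟨m| D(tξ) |n⟩` for real `t`, continued to an entire function of `t`. -/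
def displacementElement (n : ℕ) (ξ : ℂ) (m : ℕ) (t : ℂ) : ℂ :=
  Complex.exp (-(t ^ 2 * (ξ * starRingEnd ℂ ξ) / 2)) *
    complexHermite m n (t * ξ) (t * -starRingEnd ℂ ξ) /
      ((√(m.factorial : ℝ) : ℝ) * (√(n.factorial : ℝ) : ℝ) : ℂ)

theorem sqrt_factorial_ne_zero (n : ℕ) : ((√(n.factorial : ℝ) : ℝ) : ℂ) ≠ 0 := by
  have : (0 : ℝ) < n.factorial := by exact_mod_cast n.factorial_pos
  exact_mod_cast (Real.sqrt_pos.mpr this).ne'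

theorem sqrt_factorial_succ (n : ℕ) : ((√((n + 1).factorial : ℝ) : ℝ) : ℂ) =
    (√((n : ℝ) + 1) : ℝ) * (√(n.factorial : ℝ) : ℝ) := by
  rw [← Complex.ofReal_mul, ← Real.sqrt_mul (by positivity), Nat.factorial_succ]
  push_cast
  rfl

theorem sqrt_mul_sqrt_cast (n : ℕ) :
    ((√((n : ℝ) + 1) : ℝ) : ℂ) * (√((n : ℝ) + 1) : ℝ) = (n : ℂ) + 1 := by
  rw [← Complex.ofReal_mul, Real.mul_self_sqrt (by positivity)]
  push_cast
  rfl

/-- The matrix elements of `D(tξ)` satisfy the differential equation `d/dt D(tξ) = X D(tξ)`,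
`X` the generator. -/
theorem hasDerivAt_displacementElement (n : ℕ) (ξ : ℂ) (m : ℕ) (t : ℂ) :
    HasDerivAt (displacementElement n ξ m)
      (ξ * ((√(m : ℝ) : ℝ) : ℂ) * displacementElement n ξ (m - 1) t -
        starRingEnd ℂ ξ * ((√((m : ℝ) + 1) : ℝ) : ℂ) * displacementElement n ξ (m + 1) t) t := by
  have h1 : HasDerivAt (fun t : ℂ => -(t ^ 2 * (ξ * starRingEnd ℂ ξ) / 2))
      (-(t * (ξ * starRingEnd ℂ ξ))) t := by
    have := (((hasDerivAt_id t).pow 2).mul_const (ξ * starRingEnd ℂ ξ)).div_const 2 |>.neg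
    refine this.congr_deriv ?_
    simp
    ring
  have h := (h1.cexp.mul (hasDerivAt_complexHermite m n ξ (-starRingEnd ℂ ξ) t)).div_const
    ((√(m.factorial : ℝ) : ℝ) * (√(n.factorial : ℝ) : ℝ) : ℂ)
  refine h.congr_deriv ?_
  have hm := sqrt_factorial_ne_zero m
  have hn := sqrt_factorial_ne_zero n
  have hm1 := sqrt_factorial_succ m
  have hsq := sqrt_mul_sqrt_cast m
  have hs0 : ((√((m : ℝ) + 1) : ℝ) : ℂ) ≠ 0 := by
    intro h0
    rw [h0, zero_mul] at hsq
    exact Nat.cast_add_one_ne_zero m hsq.symm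
  have hup : ((√((m : ℝ) + 1) : ℝ) : ℂ) * displacementElement n ξ (m + 1) t =
      Complex.exp (-(t ^ 2 * (ξ * starRingEnd ℂ ξ) / 2)) *
        (t * ξ * complexHermite m n (t * ξ) (t * -starRingEnd ℂ ξ) +
          n * complexHermite m (n - 1) (t * ξ) (t * -starRingEnd ℂ ξ)) /
        ((√(m.factorial : ℝ) : ℝ) * (√(n.factorial : ℝ) : ℝ) : ℂ) := by
    rw [displacementElement, hm1, complexHermite_succ_left]
    field_simp
  have hdown : ((√(m : ℝ) : ℝ) : ℂ) * displacementElement n ξ (m - 1) t =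
      Complex.exp (-(t ^ 2 * (ξ * starRingEnd ℂ ξ) / 2)) *
        (m * complexHermite (m - 1) n (t * ξ) (t * -starRingEnd ℂ ξ)) /
        ((√(m.factorial : ℝ) : ℝ) * (√(n.factorial : ℝ) : ℝ) : ℂ) := by
    rcases m with _ | m
    · simp
    · have hm := sqrt_factorial_ne_zero m
      have hsq := sqrt_mul_sqrt_cast m
      have hs0 : ((√((m : ℝ) + 1) : ℝ) : ℂ) ≠ 0 := by
        intro h0
        rw [h0, zero_mul] at hsq
        exact Nat.cast_add_one_ne_zero m hsq.symm
      rw [displacementElement, sqrt_factorial_succ m, Nat.add_sub_cancel]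
      push_cast
      rw [← hsq]
      field_simp
  rw [mul_assoc ξ ((√(m : ℝ) : ℝ) : ℂ), mul_assoc (starRingEnd ℂ ξ), hup, hdown]
  ring

theorem displacementElement_zero (n : ℕ) (ξ : ℂ) (m : ℕ) :
    displacementElement n ξ m 0 = if n = m then 1 else 0 := by
  have hn := sqrt_factorial_ne_zero n
  rw [displacementElement, zero_mul, zero_mul, complexHermite_zero_zero]
  by_cases h : m = n
  · subst h
    rw [← Complex.ofReal_mul, Real.mul_self_sqrt (by positivity)]
    have : (m.factorial : ℂ) ≠ 0 := by exact_mod_cast m.factorial_ne_zero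
    simp [this]
  · simp [h, Ne.symm h]

theorem iteratedDeriv_displacementElement (n : ℕ) (ξ : ℂ) (k m : ℕ) :
    iteratedDeriv k (displacementElement n ξ m) 0 =
      ((displacementGenerator ξ ^ k) (Finsupp.single n 1)) m := by
  have hdiff : ∀ m, Differentiable ℂ (displacementElement n ξ m) := fun m t =>
    (hasDerivAt_displacementElement n ξ m t).differentiableAt
  induction k generalizing m with
  | zero => simp [displacementElement_zero, Finsupp.single_apply]
  | succ k ih =>
    have hd : deriv (displacementElement n ξ m) =
        (fun t => ξ * ((√(m : ℝ) : ℝ) : ℂ) * displacementElement n ξ (m - 1) t) -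
        fun t => starRingEnd ℂ ξ * ((√((m : ℝ) + 1) : ℝ) : ℂ) *
          displacementElement n ξ (m + 1) t :=
      funext fun t => (hasDerivAt_displacementElement n ξ m t).deriv
    have hc : ∀ m, ContDiffAt ℂ k (displacementElement n ξ m) 0 := fun m =>
      (hdiff m).contDiff.contDiffAt
    rw [iteratedDeriv_succ', hd, iteratedDeriv_sub (contDiffAt_const.mul (hc _))
      (contDiffAt_const.mul (hc _)), iteratedDeriv_const_mul_field, iteratedDeriv_const_mul_field,
      ih, ih, pow_succ', Module.End.mul_apply, displacementGenerator_apply]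

/-- `⟨m| D(ξ) |n⟩ = exp(-|ξ|²/2) H_{mn}(ξ, -ξ*) / √(m! n!)`, by Taylor expansion in `t` of the
solution of the differential equation satisfied by `D(tξ)`. -/
theorem displacedNumberState_apply (ξ : ℂ) (n m : ℕ) :
    displacedNumberState ξ n m = displacementElement n ξ m 1 := by
  have hdiff : Differentiable ℂ (displacementElement n ξ m) := fun t =>
    (hasDerivAt_displacementElement n ξ m t).differentiableAt
  have h1 := Complex.hasSum_taylorSeries_of_entire hdiff 0 1
  have h2 := (hasSum_displacedNumberState ξ n).mapL (innerSL ℂ (numberState m))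
  simp only [innerSL_apply_apply, inner_numberState] at h2
  refine h2.unique (h1.congr_fun fun k => ?_)
  rw [iteratedDeriv_displacementElement, ← inner_numberState_finiteToMode, ← inner_numberState,
    inner_smul_right]
  simp

/-- The radial part `e^{-x/2} H_{n+d,n}(√x, -√x) / √((n+d)! n!)` of the displacement matrix elements
(a Laguerre function), at `x = |ξ|²`. -/
def radialElement (d n : ℕ) (x : ℝ) : ℂ :=
  ((Real.exp (-x / 2) : ℝ) : ℂ) * complexHermite (n + d) n ((√x : ℝ) : ℂ) (-((√x : ℝ) : ℂ)) /
    ((√((n + d).factorial : ℝ) : ℝ) * (√(n.factorial : ℝ) : ℝ) : ℂ)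

theorem displacedNumberState_phase (r θ : ℝ) (n m : ℕ) :
    displacedNumberState ((r : ℂ) * Complex.exp (θ * Complex.I)) n m =
      Complex.exp (((m : ℤ) - (n : ℤ) : ℤ) * (θ * Complex.I)) * displacedNumberState r n m := by
  have hconj : starRingEnd ℂ (Complex.exp (θ * Complex.I)) = Complex.exp (-(θ * Complex.I)) := by
    rw [← Complex.exp_conj, map_mul, Complex.conj_ofReal, Complex.conj_I, mul_neg]
  have hab : Complex.exp (θ * Complex.I) * Complex.exp (-(θ * Complex.I)) = 1 := by
    rw [← Complex.exp_add, add_neg_cancel, Complex.exp_zero]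
  rw [displacedNumberState_apply, displacedNumberState_apply, displacementElement,
    displacementElement, map_mul, hconj, Complex.conj_ofReal]
  have h1 : (r : ℂ) * Complex.exp (θ * Complex.I) * (r * Complex.exp (-(θ * Complex.I))) =
      r * r := by linear_combination (r * r : ℂ) * hab
  have h2 : Complex.exp (((m : ℤ) - (n : ℤ) : ℤ) * (θ * Complex.I)) =
      Complex.exp (θ * Complex.I) ^ m * Complex.exp (-(θ * Complex.I)) ^ n := by
    rw [← Complex.exp_nat_mul, ← Complex.exp_nat_mul, ← Complex.exp_add]
    congr 1
    push_cast
    ring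
  have h3 := complexHermite_smul m n _ _ (1 * (r : ℂ)) (1 * (-(r : ℂ))) hab
  rw [h1, h2, show (1 : ℂ) * (r * Complex.exp (θ * Complex.I)) =
      Complex.exp (θ * Complex.I) * (1 * r) by ring,
    show (1 : ℂ) * -(r * Complex.exp (-(θ * Complex.I))) =
      Complex.exp (-(θ * Complex.I)) * (1 * -r) by ring, h3]
  ring

theorem displacedNumberState_sqrt_add (d n : ℕ) {x : ℝ} (hx : 0 ≤ x) :
    displacedNumberState ((√x : ℝ) : ℂ) n (n + d) = radialElement d n x := by
  rw [displacedNumberState_apply, displacementElement, radialElement, Complex.conj_ofReal,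
    ← Complex.ofReal_mul, Real.mul_self_sqrt hx]
  push_cast
  rw [one_mul, one_mul, one_pow, one_mul, neg_div]

theorem displacedNumberState_add_sqrt (d n : ℕ) {x : ℝ} (hx : 0 ≤ x) :
    displacedNumberState ((√x : ℝ) : ℂ) (n + d) n = (-1) ^ d * radialElement d n x := by
  rw [displacedNumberState_apply, displacementElement, radialElement, Complex.conj_ofReal,
    ← Complex.ofReal_mul, Real.mul_self_sqrt hx, complexHermite_symm]
  have h := complexHermite_smul (n + d) n (-1) (-1) ((√x : ℝ) : ℂ) (-((√x : ℝ) : ℂ)) (by norm_num)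
  rw [show (-1 : ℂ) * ((√x : ℝ) : ℂ) = 1 * -((√x : ℝ) : ℂ) by ring,
    show (-1 : ℂ) * -((√x : ℝ) : ℂ) = 1 * ((√x : ℝ) : ℂ) by ring] at h
  rw [h, pow_add]
  have h1 : ((-1 : ℂ) ^ n) * (-1) ^ n = 1 := by rw [← mul_pow]; norm_num
  push_cast
  rw [one_pow, one_mul, neg_div]
  linear_combination (Complex.exp (-(↑x / 2)) * (-1) ^ d * complexHermite (n + d) n ↑√x (-↑√x) /
    (((√((n + d).factorial : ℝ) : ℝ) : ℂ) * ((√(n.factorial : ℝ) : ℝ) : ℂ))) * h1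

/-! ### Trace-class operators -/

section TraceClass

variable {H : Type u} [NormedAddCommGroup H] [InnerProductSpace ℂ H]

theorem sum_re_inner_le_of_hasTrace [CompleteSpace H] {T : H →L[ℂ] H}
    (hT : T.IsPositive) {t : ℂ}
    (ht : HasTrace T t) {u : ℕ → H} (hu : Orthonormal ℂ u) (S : Finset ℕ) :
    ∑ n ∈ S, (⟪u n, T (u n)⟫_ℂ).re ≤ t.re := by
  classical
  obtain ⟨w, b, hw, hb⟩ := hu.toSubtypeRange.exists_hilbertBasis_extension
  have h := Complex.hasSum_re (ht w b)
  let e : ℕ ↪ w := ⟨fun n => ⟨u n, hw ⟨n, rfl⟩⟩, fun i j hij =>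
    hu.linearIndependent.injective (congrArg Subtype.val hij)⟩
  have he : ∀ n, b (e n) = u n := fun n => by rw [hb]; rfl
  calc ∑ n ∈ S, (⟪u n, T (u n)⟫_ℂ).re = ∑ i ∈ S.map e, (⟪b i, T (b i)⟫_ℂ).re := by
        rw [Finset.sum_map]
        exact Finset.sum_congr rfl fun n _ => by rw [he]
    _ ≤ t.re := sum_le_hasSum (S.map e) (fun i _ => hT.re_inner_nonneg_right (b i)) h

/-- For a positive operator of finite trace, the Cauchy–Schwarz inequality for `⟪x, T y⟫` bounds
the diagonal between any two orthonormal sequences by the trace; by linearity, the diagonal of a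
trace-class operator is bounded uniformly in the two sequences. -/
theorem exists_sum_norm_inner_le_of_mem_traceClass [CompleteSpace H] {T : H →L[ℂ] H}
    (hT : T ∈ traceClass H) :
    ∃ C : ℝ, ∀ u v : ℕ → H, Orthonormal ℂ u → Orthonormal ℂ v → ∀ S : Finset ℕ,
      ∑ n ∈ S, ‖⟪u n, T (v n)⟫_ℂ‖ ≤ C := by
  induction hT using Submodule.span_induction with
  | mem T hT =>
    obtain ⟨hpos, t, ht⟩ := hT
    refine ⟨t.re, fun u v hu hv S => ?_⟩
    have hsq : ∀ x, (⟪x, T x⟫_ℂ).re = ‖CFC.sqrt T x‖ ^ 2 := fun x => by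
      rw [hpos.inner_eq_inner_sqrt, inner_self_eq_norm_sq_to_K]
      norm_cast
    have hle : ∀ n, ‖⟪u n, T (v n)⟫_ℂ‖ ≤
        ((⟪u n, T (u n)⟫_ℂ).re + (⟪v n, T (v n)⟫_ℂ).re) / 2 := fun n => by
      rw [hsq, hsq, hpos.inner_eq_inner_sqrt]
      refine (norm_inner_le_norm _ _).trans ?_
      nlinarith [sq_nonneg (‖CFC.sqrt T (u n)‖ - ‖CFC.sqrt T (v n)‖)]
    refine (Finset.sum_le_sum fun n _ => hle n).trans ?_
    rw [← Finset.sum_div, Finset.sum_add_distrib]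
    have h1 := sum_re_inner_le_of_hasTrace hpos ht hu S
    have h2 := sum_re_inner_le_of_hasTrace hpos ht hv S
    linarith
  | zero => exact ⟨0, fun u v _ _ S => by simp⟩
  | add T T' _ _ h h' =>
    obtain ⟨C, hC⟩ := h
    obtain ⟨C', hC'⟩ := h'
    refine ⟨C + C', fun u v hu hv S => ?_⟩
    refine le_trans ?_ (add_le_add (hC u v hu hv S) (hC' u v hu hv S))
    rw [← Finset.sum_add_distrib]
    refine Finset.sum_le_sum fun n _ => ?_
    rw [add_apply, inner_add_right]
    exact norm_add_le _ _
  | smul a T _ h =>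
    obtain ⟨C, hC⟩ := h
    refine ⟨‖a‖ * C, fun u v hu hv S => ?_⟩
    refine le_trans (le_of_eq ?_) (mul_le_mul_of_nonneg_left (hC u v hu hv S) (norm_nonneg a))
    rw [Finset.mul_sum]
    refine Finset.sum_congr rfl fun n _ => ?_
    rw [smul_apply, inner_smul_right, norm_mul]

theorem summable_inner_of_mem_traceClass [CompleteSpace H] {T : H →L[ℂ] H}
    (hT : T ∈ traceClass H) {u v : ℕ → H}
    (hu : Orthonormal ℂ u) (hv : Orthonormal ℂ v) :
    Summable fun n => ‖⟪u n, T (v n)⟫_ℂ‖ := by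
  obtain ⟨C, hC⟩ := exists_sum_norm_inner_le_of_mem_traceClass hT
  exact summable_of_sum_le (fun _ => norm_nonneg _) (hC u v hu hv)

theorem isDensityOperator_ketBra_self {x : H} (hx : ‖x‖ = 1) :
    IsDensityOperator (ketBra x x : H →L[ℂ] H) := by
  refine ⟨InnerProductSpace.isPositive_rankOne_self x, fun ι b => ?_⟩
  have h := b.hasSum_inner_mul_inner x x
  rw [inner_self_eq_norm_sq_to_K, hx] at h
  simp only [RCLike.ofReal_one, one_pow] at h
  refine h.congr_fun fun i => ?_
  simp [ketBra, InnerProductSpace.rankOne_apply]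

theorem ketBra_smul_smul (a : ℝ) (x : H) :
    ketBra ((a : ℂ) • x) ((a : ℂ) • x) = ((a : ℂ) ^ 2) • ketBra x x := by
  ext z
  simp only [ketBra, InnerProductSpace.rankOne_apply, Submodule.coe_smul,
    smul_apply, inner_smul_left, smul_smul, Complex.conj_ofReal]
  congr 1
  ring

/-- Polarization. -/
theorem ketBra_eq_polarization (x y : H) : ketBra x y = (1 / 4 : ℂ) •
    (ketBra (x + y) (x + y) - ketBra (x - y) (x - y)
      + Complex.I • ketBra (x + Complex.I • y) (x + Complex.I • y)
      - Complex.I • ketBra (x - Complex.I • y) (x - Complex.I • y)) := by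
  ext z
  simp only [ketBra, Submodule.coe_smul, Submodule.coe_sub, Submodule.coe_add,
    InnerProductSpace.rankOne_apply, smul_apply, add_apply,
    sub_apply, inner_add_left, inner_sub_left, inner_smul_left, Complex.conj_I]
  match_scalars <;> ring_nf <;> simp only [Complex.I_sq] <;> ring

theorem ketBra_mem_of_isDensityOperator (V : Submodule ℂ (traceClass H))
    (hV : ∀ T : traceClass H, IsDensityOperator (T : H →L[ℂ] H) → T ∈ V) (x y : H) :
    ketBra x y ∈ V := by
  have hself : ∀ x : H, ketBra x x ∈ V := fun x => by
    by_cases hx : x = 0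
    · have : ketBra x x = 0 := by ext z; simp [ketBra, hx]
      rw [this]
      exact V.zero_mem
    · have hn : ‖x‖ ≠ 0 := norm_ne_zero_iff.mpr hx
      have h1 : ((‖x‖ : ℝ) : ℂ) • ((‖x‖⁻¹ : ℝ) : ℂ) • x = x := by
        rw [smul_smul, ← Complex.ofReal_mul, mul_inv_cancel₀ hn, Complex.ofReal_one, one_smul]
      rw [← h1, ketBra_smul_smul]
      refine V.smul_mem _ (hV _ (isDensityOperator_ketBra_self ?_))
      rw [norm_smul, Complex.norm_real, norm_inv, norm_norm, inv_mul_cancel₀ hn]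
  rw [ketBra_eq_polarization]
  exact V.smul_mem _ (V.sub_mem (V.add_mem (V.sub_mem (hself _) (hself _))
    (V.smul_mem _ (hself _))) (V.smul_mem _ (hself _)))

end TraceClass

/-! ### Characteristic functions -/

theorem hasSum_charFunction {T : Mode →L[ℂ] Mode} (hT : T ∈ traceClass Mode) (ξ : ℂ) :
    HasSum (fun n => ⟪numberState n, T (displacedNumberState ξ n)⟫_ℂ) (charFunction T ξ) :=
  (summable_inner_of_mem_traceClass hT orthonormal_numberState
    (orthonormal_displacedNumberState ξ)).of_norm.hasSum

/-- The characteristic function at `ξ`, as a linear functional of the trace-class operator. -/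
def charFunctionLM (ξ : ℂ) : traceClass Mode →ₗ[ℂ] ℂ where
  toFun T := charFunction (T : Mode →L[ℂ] Mode) ξ
  map_add' T T' := by
    refine (hasSum_charFunction (T + T').2 ξ).unique ?_
    refine ((hasSum_charFunction T.2 ξ).add (hasSum_charFunction T'.2 ξ)).congr_fun fun n => ?_
    rw [Submodule.coe_add, add_apply, inner_add_right]
  map_smul' a T := by
    refine (hasSum_charFunction (a • T).2 ξ).unique ?_
    refine ((hasSum_charFunction T.2 ξ).mul_left a).congr_fun fun n => ?_
    rw [Submodule.coe_smul, smul_apply, inner_smul_right]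

theorem charFunction_ketBra_numberState (p q : ℕ) (ξ : ℂ) :
    charFunction (ketBra (numberState p) (numberState q) : Mode →L[ℂ] Mode) ξ =
      displacedNumberState ξ p q := by
  have h : ∀ n, ⟪numberState n, (ketBra (numberState p) (numberState q) : Mode →L[ℂ] Mode)
      (displacedNumberState ξ n)⟫_ℂ = if n = p then displacedNumberState ξ p q else 0 := fun n => by
    simp only [ketBra, InnerProductSpace.rankOne_apply, inner_smul_right,
      orthonormal_iff_ite.mp orthonormal_numberState]
    rw [inner_numberState]
    split_ifs with hn
    · rw [hn, mul_one]
    · rw [mul_zero]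
  rw [charFunction, tsum_congr h, tsum_ite_eq]

/-- The defining relation of the amplifier extends from states to the operators `|p⟩⟨q|`, which
are combinations of pure states. -/
theorem IsQuantumLimitedAmplifier.charFunction_map_ketBra {G : ℝ} {𝒜 : QuantumChannel Mode}
    (h𝒜 : IsQuantumLimitedAmplifier G 𝒜) (p q : ℕ) (ξ : ℂ) :
    charFunction (𝒜.map (ketBra (numberState p) (numberState q)) : Mode →L[ℂ] Mode) ξ =
      displacedNumberState (((√G : ℝ) : ℂ) * ξ) p q *
        ((Real.exp (-(G - 1) * ‖ξ‖ ^ 2 / 2) : ℝ) : ℂ) := by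
  let V : Submodule ℂ (traceClass Mode) := LinearMap.eqLocus ((charFunctionLM ξ).comp 𝒜.map)
    (((Real.exp (-(G - 1) * ‖ξ‖ ^ 2 / 2) : ℝ) : ℂ) • charFunctionLM (((√G : ℝ) : ℂ) * ξ))
  have hmem := ketBra_mem_of_isDensityOperator V (fun T hT => by
    have := h𝒜 T hT ξ
    rw [mul_comm] at this
    exact this) (numberState p) (numberState q)
  rw [← charFunction_ketBra_numberState, mul_comm]
  exact hmem

/-! ### Phase averages of characteristic functions -/

theorem hasSum_inner_apply (T : Mode →L[ℂ] Mode) (n : ℕ) (v : Mode) :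
    HasSum (fun m => ⟪numberState n, T (numberState m)⟫_ℂ * v m) ⟪numberState n, T v⟫_ℂ := by
  have h := lp.hasSum_inner (𝕜 := ℂ) (ContinuousLinearMap.adjoint T (numberState n)) v
  rw [ContinuousLinearMap.adjoint_inner_left] at h
  refine h.congr_fun fun m => ?_
  rw [← ContinuousLinearMap.adjoint_inner_left, ← inner_conj_symm, inner_numberState,
    RCLike.inner_apply, mul_comm]

theorem integral_exp_int_mul_I (j : ℤ) :
    ∫ θ in Set.Ioc (0 : ℝ) (2 * Real.pi), Complex.exp ((j : ℂ) * (θ * Complex.I)) =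
      if j = 0 then (2 * Real.pi : ℂ) else 0 := by
  rw [← intervalIntegral.integral_of_le (by positivity)]
  split_ifs with h
  · simp [h]
  · have hj : (j : ℂ) * Complex.I ≠ 0 := by simp [h]
    have h1 := integral_exp_mul_complex (a := 0) (b := 2 * Real.pi) hj
    have h2 : ∀ θ : ℝ, (j : ℂ) * (θ * Complex.I) = (j : ℂ) * Complex.I * θ := fun θ => by ring
    simp only [h2]
    rw [h1]
    have h3 : Complex.exp ((j : ℂ) * Complex.I * ((2 * Real.pi : ℝ) : ℂ)) = 1 := by
      rw [Complex.exp_eq_one_iff]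
      exact ⟨j, by push_cast; ring⟩
    rw [h3]
    simp

/-- Averaging the characteristic function of `T` over the phase of `ξ` against `exp(-i e θ)` picks
out the part of `Tr T D(ξ)` that comes from the `e`-th diagonal of `T`. -/
theorem hasSum_diagonal_of_charFunction {T : Mode →L[ℂ] Mode} (hT : T ∈ traceClass Mode) (r : ℝ)
    {f : ℤ} {c : ℂ} (hχ : ∀ θ : ℝ, charFunction T ((r : ℂ) * Complex.exp (θ * Complex.I)) =
      Complex.exp (f * (θ * Complex.I)) * c) (e : ℤ) :
    HasSum (fun n : ℕ => ∑' m : ℕ, if (m : ℤ) - n = e then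
      ⟪numberState n, T (numberState m)⟫_ℂ * displacedNumberState r n m else 0)
      (if f = e then c else 0) := by
  set b : ℕ → ℕ → ℂ := fun n m =>
    ⟪numberState n, T (numberState m)⟫_ℂ * displacedNumberState r n m with hb
  have hbs : ∀ n, Summable fun m => ‖b n m‖ := fun n =>
    (hasSum_inner_apply T n (displacedNumberState r n)).summable.norm
  set I : Set ℝ := Set.Ioc (0 : ℝ) (2 * Real.pi) with hI
  have hvol : (volume : Measure ℝ).real I = 2 * Real.pi := by
    simp [hI, Real.pi_pos.le]
  have hnorm : ∀ (j : ℤ) (θ : ℝ), ‖Complex.exp ((j : ℂ) * (θ * Complex.I))‖ = 1 := fun j θ => by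
    rw [show (j : ℂ) * (θ * Complex.I) = ((j * θ : ℝ) : ℂ) * Complex.I by push_cast; ring]
    exact Complex.norm_exp_ofReal_mul_I _
  have hcont : ∀ j : ℤ, Continuous fun θ : ℝ => Complex.exp ((j : ℂ) * (θ * Complex.I)) :=
    fun j => by fun_prop
  let F : ℕ → ℝ → ℂ := fun n θ => Complex.exp ((-e : ℤ) * (θ * Complex.I)) *
    ⟪numberState n, T (displacedNumberState ((r : ℂ) * Complex.exp (θ * Complex.I)) n)⟫_ℂ
  have hF : ∀ (n : ℕ) (θ : ℝ), HasSum (fun m : ℕ =>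
      Complex.exp (((m : ℤ) - n - e : ℤ) * (θ * Complex.I)) * b n m) (F n θ) := fun n θ => by
    refine ((hasSum_inner_apply T n _).mul_left _).congr_fun fun m => ?_
    rw [displacedNumberState_phase, hb]
    have : Complex.exp (((m : ℤ) - n - e : ℤ) * (θ * Complex.I)) =
        Complex.exp ((-e : ℤ) * (θ * Complex.I)) *
          Complex.exp (((m : ℤ) - (n : ℤ) : ℤ) * (θ * Complex.I)) := by
      rw [← Complex.exp_add]
      congr 1
      push_cast
      ring
    rw [this]
    ring
  have hFcont : ∀ n, Continuous (F n) := fun n => by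
    have h1 : F n = fun θ : ℝ => ∑' m : ℕ,
        Complex.exp (((m : ℤ) - n - e : ℤ) * (θ * Complex.I)) * b n m :=
      funext fun θ => (hF n θ).tsum_eq.symm
    rw [h1]
    refine continuous_tsum (fun m => (hcont _).mul continuous_const) (hbs n) fun m θ => ?_
    rw [norm_mul, hnorm, one_mul]
  have hFint : ∀ n, Integrable (F n) (volume.restrict I) := fun n =>
    (hFcont n).integrableOn_Ioc
  -- The inner series is integrated termwise.
  have hFI : ∀ n, ∫ θ in I, F n θ = (2 * Real.pi : ℂ) *
      ∑' m : ℕ, if (m : ℤ) - n = e then b n m else 0 := fun n => by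
    have h1 := hasSum_integral_of_summable_integral_norm (μ := volume.restrict I)
      (F := fun (m : ℕ) (θ : ℝ) =>
        Complex.exp (((m : ℤ) - n - e : ℤ) * (θ * Complex.I)) * b n m)
      (fun m => ((hcont _).mul continuous_const).integrableOn_Ioc) (by
        simp only [norm_mul, hnorm, one_mul, integral_const, smul_eq_mul]
        exact (hbs n).mul_left _)
    rw [integral_congr_ae (g := fun θ : ℝ => ∑' m : ℕ,
      Complex.exp (((m : ℤ) - n - e : ℤ) * (θ * Complex.I)) * b n m)
      (Eventually.of_forall fun θ => (hF n θ).tsum_eq.symm), ← h1.tsum_eq, ← tsum_mul_left]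
    refine tsum_congr fun m => ?_
    rw [integral_mul_const, integral_exp_int_mul_I]
    by_cases h : (m : ℤ) - n = e
    · simp [h]
    · simp [h, sub_eq_zero]
  -- The trace is integrated termwise, its partial sums being bounded uniformly in the phase.
  obtain ⟨C, hC⟩ := exists_sum_norm_inner_le_of_mem_traceClass hT
  have hsum : Summable fun n => ∫ θ in I, ‖F n θ‖ := by
    refine summable_of_sum_le (c := C * (2 * Real.pi))
      (fun n => integral_nonneg fun _ => norm_nonneg _) fun S => ?_
    rw [← integral_finsetSum _ fun n _ => (hFint n).norm]
    have h1 : ∫ θ in I, ∑ n ∈ S, ‖F n θ‖ ≤ ∫ θ in I, C := by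
      refine integral_mono (integrable_finsetSum _ fun n _ => (hFint n).norm)
        (continuous_const.integrableOn_Ioc) fun θ => ?_
      simp only [F, norm_mul, hnorm, one_mul]
      exact hC _ _ orthonormal_numberState (orthonormal_displacedNumberState _) S
    rw [integral_const] at h1
    simpa [hvol, mul_comm] using h1
  have hmain := hasSum_integral_of_summable_integral_norm hFint hsum
  have htot : ∀ θ : ℝ, ∑' n, F n θ = Complex.exp ((f - e : ℤ) * (θ * Complex.I)) * c := fun θ => by
    rw [((hasSum_charFunction hT _).mul_left _).tsum_eq, hχ, ← mul_assoc, ← Complex.exp_add]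
    congr 2
    push_cast
    ring
  simp only [htot, hFI] at hmain
  rw [integral_mul_const, integral_exp_int_mul_I] at hmain
  have hpi : (2 * Real.pi : ℂ) ≠ 0 := by simp [Real.pi_ne_zero]
  have h2 := hmain.mul_left (2 * Real.pi : ℂ)⁻¹
  have hval : (2 * Real.pi : ℂ)⁻¹ * ((if f - e = 0 then (2 * Real.pi : ℂ) else 0) * c) =
      if f = e then c else 0 := by
    by_cases h : f = e
    · simp only [h, sub_self, if_true]
      field_simp
    · simp [h, sub_eq_zero]
  rw [hval] at h2
  refine h2.congr_fun fun n => ?_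
  rw [← mul_assoc, inv_mul_cancel₀ hpi, one_mul]

/-! ### Laplace transforms of the radial matrix elements -/

theorem integral_pow_mul_exp_neg (d : ℕ) {s : ℝ} (hs : 0 < s) :
    ∫ x in Set.Ioi (0 : ℝ), x ^ d * Real.exp (-(s * x)) = d.factorial / s ^ (d + 1) := by
  have h := Real.integral_rpow_mul_exp_neg_mul_Ioi (a := (d : ℝ) + 1) (by positivity) hs
  rw [Real.Gamma_nat_eq_factorial] at h
  simp only [add_sub_cancel_right, Real.rpow_natCast] at h
  rw [h, ← Nat.cast_add_one, Real.rpow_natCast]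
  simp [div_eq_mul_inv, mul_comm]

theorem integrableOn_pow_mul_exp_neg (d : ℕ) {s : ℝ} (hs : 0 < s) :
    IntegrableOn (fun x : ℝ => x ^ d * Real.exp (-(s * x))) (Set.Ioi 0) := by
  -- The integral is nonzero, hence not the default value `0` of a divergent integral.
  by_contra h
  have h1 := integral_pow_mul_exp_neg d hs
  rw [integral_undef h] at h1
  have : (0 : ℝ) < d.factorial / s ^ (d + 1) := by
    have := d.factorial_pos
    positivity
  linarith

/-- The function `√x^d e^{-sx} H_{n+d,n}(√x, -√x)`. -/
def laplaceIntegrand (s : ℝ) (d n : ℕ) (x : ℝ) : ℂ :=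
  ((√x ^ d * Real.exp (-(s * x)) : ℝ) : ℂ) *
    complexHermite (n + d) n ((√x : ℝ) : ℂ) (-((√x : ℝ) : ℂ))

theorem laplaceIntegrand_zero (s : ℝ) (d : ℕ) {x : ℝ} (hx : 0 ≤ x) :
    laplaceIntegrand s d 0 x = ((x ^ d * Real.exp (-(s * x)) : ℝ) : ℂ) := by
  have : (x : ℂ) = (√x : ℝ) * (√x : ℝ) := by rw [← Complex.ofReal_mul, Real.mul_self_sqrt hx]
  simp only [laplaceIntegrand, complexHermite, zero_add]
  push_cast
  rw [this]
  ring

theorem laplaceIntegrand_succ (s : ℝ) (d n : ℕ) (x : ℝ) :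
    laplaceIntegrand s d (n + 1) x =
      ((n + 1 + d : ℕ) : ℂ) * laplaceIntegrand s d n x - laplaceIntegrand s (d + 1) n x := by
  rw [laplaceIntegrand, complexHermite_succ_right, laplaceIntegrand, laplaceIntegrand,
    show n + 1 + d = n + (d + 1) by omega, show n + (d + 1) - 1 = n + d by omega]
  push_cast
  ring

theorem integrableOn_laplaceIntegrand {s : ℝ} (hs : 0 < s) (d n : ℕ) :
    IntegrableOn (laplaceIntegrand s d n) (Set.Ioi 0) := by
  induction n generalizing d with
  | zero =>
    have h : IntegrableOn (fun x : ℝ => ((x ^ d * Real.exp (-(s * x)) : ℝ) : ℂ)) (Set.Ioi 0) :=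
      (integrableOn_pow_mul_exp_neg d hs).ofReal
    exact h.congr_fun (fun x hx => (laplaceIntegrand_zero s d (le_of_lt hx)).symm) measurableSet_Ioi
  | succ n ih =>
    have : laplaceIntegrand s d (n + 1) = fun x =>
        ((n + 1 + d : ℕ) : ℂ) * laplaceIntegrand s d n x - laplaceIntegrand s (d + 1) n x :=
      funext fun x => laplaceIntegrand_succ s d n x
    rw [this]
    exact ((ih d).const_mul _).sub (ih (d + 1))

/-- By induction on `n`, through the recursion of the complex Hermite polynomials. -/
theorem integral_laplaceIntegrand {s : ℝ} (hs : 0 < s) (d n : ℕ) :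
    ∫ x in Set.Ioi (0 : ℝ), laplaceIntegrand s d n x =
      ((n + d).factorial : ℂ) / (s : ℂ) ^ (d + 1) * (1 - (s : ℂ)⁻¹) ^ n := by
  have hs0 : (s : ℂ) ≠ 0 := by exact_mod_cast hs.ne'
  induction n generalizing d with
  | zero =>
    rw [setIntegral_congr_fun measurableSet_Ioi
      (fun x hx => laplaceIntegrand_zero s d (le_of_lt hx)), integral_complex_ofReal,
      integral_pow_mul_exp_neg d hs]
    simp
  | succ n ih =>
    simp only [laplaceIntegrand_succ]
    rw [integral_sub ((integrableOn_laplaceIntegrand hs d n).const_mul _)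
      (integrableOn_laplaceIntegrand hs (d + 1) n), integral_const_mul, ih, ih,
      show n + 1 + d = (n + d) + 1 by omega, show n + (d + 1) = (n + d) + 1 by omega,
      Nat.factorial_succ, pow_succ (1 - (s : ℂ)⁻¹), pow_succ (s : ℂ) (d + 1)]
    push_cast
    field_simp

theorem norm_radialElement_le (d n : ℕ) {x : ℝ} (hx : 0 ≤ x) : ‖radialElement d n x‖ ≤ 1 := by
  rw [← displacedNumberState_sqrt_add d n hx]
  refine (lp.norm_apply_le_norm (by norm_num) _ _).trans ?_
  rw [(orthonormal_displacedNumberState _).1]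

/-- The weight `√x^d e^{-(s-1/2)x}` against which the radial matrix elements are integrated. -/
def laplaceWeight (s : ℝ) (d : ℕ) (x : ℝ) : ℝ := √x ^ d * Real.exp (-((s - 1 / 2) * x))

theorem laplaceWeight_mul_radialElement (s : ℝ) (d n : ℕ) (x : ℝ) :
    (laplaceWeight s d x : ℂ) * radialElement d n x = laplaceIntegrand s d n x /
      ((√((n + d).factorial : ℝ) : ℝ) * (√(n.factorial : ℝ) : ℝ) : ℂ) := by
  have h : Real.exp (-(s * x)) = Real.exp (-((s - 1 / 2) * x)) * Real.exp (-x / 2) := by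
    rw [← Real.exp_add]
    congr 1
    ring
  rw [laplaceWeight, radialElement, laplaceIntegrand, h]
  push_cast
  ring

theorem integrableOn_laplaceWeight {s : ℝ} (hs : 1 / 2 < s) (d : ℕ) :
    IntegrableOn (laplaceWeight s d) (Set.Ioi 0) := by
  have hs' : 0 < s - 1 / 2 := by linarith
  refine Integrable.mono' ((integrableOn_pow_mul_exp_neg d hs').add
    (integrableOn_pow_mul_exp_neg 0 hs')) ?_ ?_
  · exact Continuous.aestronglyMeasurable (by unfold laplaceWeight; fun_prop)
  · refine (ae_restrict_mem measurableSet_Ioi).mono fun x hx => ?_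
    have hx0 : (0 : ℝ) < x := hx
    have h1 : √x ^ d ≤ x ^ d + 1 := by
      rcases le_total 1 x with h | h
      · have : √x ≤ x := by
          rw [Real.sqrt_le_left (by linarith)]
          nlinarith
        have := pow_le_pow_left₀ (Real.sqrt_nonneg x) this d
        linarith
      · have : √x ≤ 1 := Real.sqrt_le_one.mpr h
        have := pow_le_one₀ (Real.sqrt_nonneg x) this (n := d)
        have : 0 ≤ x ^ d := by positivity
        linarith
    have h2 : 0 ≤ laplaceWeight s d x := by unfold laplaceWeight; positivity
    rw [Real.norm_of_nonneg h2, laplaceWeight, Pi.add_apply, pow_zero, ← add_mul]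
    gcongr

theorem laplaceWeight_nonneg (s : ℝ) (d : ℕ) (x : ℝ) : 0 ≤ laplaceWeight s d x := by
  unfold laplaceWeight; positivity

theorem integral_laplaceWeight_mul_radialElement {s : ℝ} (hs : 0 < s) (d n : ℕ) :
    ∫ x in Set.Ioi (0 : ℝ), (laplaceWeight s d x : ℂ) * radialElement d n x =
      ((√((n + d).factorial : ℝ) : ℝ) / (√(n.factorial : ℝ) : ℝ) : ℂ) / (s : ℂ) ^ (d + 1) *
        (1 - (s : ℂ)⁻¹) ^ n := by
  simp only [laplaceWeight_mul_radialElement]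
  rw [integral_div, integral_laplaceIntegrand hs]
  have h : ((n + d).factorial : ℂ) =
      (√((n + d).factorial : ℝ) : ℝ) * (√((n + d).factorial : ℝ) : ℝ) := by
    rw [← Complex.ofReal_mul, Real.mul_self_sqrt (by positivity)]
    push_cast
    rfl
  have h1 := sqrt_factorial_ne_zero (n + d)
  have h2 := sqrt_factorial_ne_zero n
  rw [h]
  field_simp

theorem hasSum_laplace_radialElement {d : ℕ} {c : ℕ → ℂ} (hc : Summable fun n => ‖c n‖)
    {g : ℝ → ℂ} (hg : ∀ x, 0 < x → HasSum (fun n => c n * radialElement d n x) (g x)) {s : ℝ}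
    (hs : 1 / 2 < s) :
    HasSum (fun n => c n * (((√((n + d).factorial : ℝ) : ℝ) / (√(n.factorial : ℝ) : ℝ) : ℂ) /
      (s : ℂ) ^ (d + 1) * (1 - (s : ℂ)⁻¹) ^ n))
      (∫ x in Set.Ioi (0 : ℝ), (laplaceWeight s d x : ℂ) * g x) := by
  have hs0 : 0 < s := by linarith
  have hint : ∀ n, IntegrableOn (fun x => c n * ((laplaceWeight s d x : ℂ) * radialElement d n x))
      (Set.Ioi 0) := fun n => by
    simp only [laplaceWeight_mul_radialElement]
    exact ((integrableOn_laplaceIntegrand hs0 d n).div_const _).const_mul _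
  have hle : ∀ n, ∫ x in Set.Ioi (0 : ℝ),
      ‖c n * ((laplaceWeight s d x : ℂ) * radialElement d n x)‖ ≤
      ‖c n‖ * ∫ x in Set.Ioi (0 : ℝ), laplaceWeight s d x := fun n => by
    rw [← integral_const_mul]
    refine setIntegral_mono_on (hint n).norm ((integrableOn_laplaceWeight hs d).const_mul _)
      measurableSet_Ioi fun x hx => ?_
    rw [norm_mul, norm_mul, Complex.norm_real, Real.norm_of_nonneg (laplaceWeight_nonneg s d x)]
    exact mul_le_mul_of_nonneg_left (mul_le_of_le_one_right (laplaceWeight_nonneg s d x)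
      (norm_radialElement_le d n (le_of_lt hx))) (norm_nonneg _)
  have h := hasSum_integral_of_summable_integral_norm hint
    ((hc.mul_right _).of_nonneg_of_le (fun n => integral_nonneg fun _ => norm_nonneg _) hle)
  have hval : ∫ x in Set.Ioi (0 : ℝ),
      ∑' n, c n * ((laplaceWeight s d x : ℂ) * radialElement d n x) =
      ∫ x in Set.Ioi (0 : ℝ), (laplaceWeight s d x : ℂ) * g x := by
    refine setIntegral_congr_fun measurableSet_Ioi fun x hx => ?_
    refine ((hg x hx).mul_left (laplaceWeight s d x : ℂ)).tsum_eq ▸ tsum_congr fun n => ?_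
    ring
  rw [hval] at h
  refine h.congr_fun fun n => ?_
  rw [integral_const_mul, integral_laplaceWeight_mul_radialElement hs0]

/-- The Laplace transform of the radial part of `D_{p+d,p}(√G ξ) exp(-(G-1)|ξ|²/2)`. -/
theorem integral_laplaceWeight_mul_amplified {G s : ℝ} (hG : 1 ≤ G) (hs : 0 < s) (d p : ℕ) :
    ∫ x in Set.Ioi (0 : ℝ), (laplaceWeight s d x : ℂ) *
        (radialElement d p (G * x) * ((Real.exp (-(G - 1) * x / 2) : ℝ) : ℂ)) =
      ((√((p + d).factorial : ℝ) : ℝ) / (√(p.factorial : ℝ) : ℝ) : ℂ) *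
        (((√G)⁻¹ ^ d * G⁻¹ : ℝ) : ℂ) / ((((s + G - 1) / G : ℝ) : ℂ)) ^ (d + 1) *
        (1 - ((((s + G - 1) / G : ℝ) : ℂ))⁻¹) ^ p := by
  have hG0 : 0 < G := by linarith
  have hs' : 0 < (s + G - 1) / G := by apply div_pos <;> linarith
  have hsq : √G ≠ 0 := (Real.sqrt_pos.mpr hG0).ne'
  have hfun : ∀ x ∈ Set.Ioi (0 : ℝ), (laplaceWeight s d x : ℂ) *
      (radialElement d p (G * x) * ((Real.exp (-(G - 1) * x / 2) : ℝ) : ℂ)) =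
      (((√G)⁻¹ ^ d : ℝ) : ℂ) * ((laplaceWeight ((s + G - 1) / G) d (G * x) : ℂ) *
        radialElement d p (G * x)) := fun x hx => by
    have h1 : laplaceWeight s d x * Real.exp (-(G - 1) * x / 2) =
        (√G)⁻¹ ^ d * laplaceWeight ((s + G - 1) / G) d (G * x) := by
      rw [laplaceWeight, laplaceWeight, Real.sqrt_mul hG0.le, mul_pow, mul_assoc, ← Real.exp_add,
        ← mul_assoc, ← mul_assoc, ← mul_pow, inv_mul_cancel₀ hsq, one_pow, one_mul]
      congr 2
      field_simp
      ring
    rw [mul_left_comm, ← Complex.ofReal_mul, h1]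
    push_cast
    ring
  rw [setIntegral_congr_fun measurableSet_Ioi hfun, integral_const_mul]
  have h2 := integral_comp_mul_left_Ioi
    (fun y => (laplaceWeight ((s + G - 1) / G) d y : ℂ) * radialElement d p y) 0 hG0
  rw [mul_zero] at h2
  rw [h2, integral_laplaceWeight_mul_radialElement hs', Complex.real_smul]
  push_cast
  ring

/-! ### Uniqueness -/

theorem eq_of_hasSum_mul_pow {a b : ℕ → ℂ} {R : ℝ → ℂ}
    (ha : ∀ w : ℝ, |w| < 1 / 2 → HasSum (fun n => a n * (w : ℂ) ^ n) (R w))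
    (hb : ∀ w : ℝ, |w| < 1 / 2 → HasSum (fun n => b n * (w : ℂ) ^ n) (R w)) : a = b := by
  let p : FormalMultilinearSeries ℝ ℝ ℂ := fun n =>
    ContinuousMultilinearMap.mkPiRing ℝ (Fin n) (a n - b n)
  have hp : HasFPowerSeriesAt 0 p (0 : ℝ) := by
    rw [hasFPowerSeriesAt_iff]
    filter_upwards [Metric.ball_mem_nhds (0 : ℝ) (by norm_num : (0 : ℝ) < 1 / 2)] with w hw
    have hw' : |w| < 1 / 2 := by simpa using hw
    have h := (ha w hw').sub (hb w hw')
    rw [sub_self] at h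
    refine h.congr_fun fun n => ?_
    simp [FormalMultilinearSeries.coeff, p]
    ring
  have h0 := hp.eq_zero
  funext n
  have h1 : p n = 0 := by rw [h0]; rfl
  have h2 := DFunLike.congr_fun h1 (fun _ => (1 : ℝ))
  simp [p] at h2
  exact sub_eq_zero.mp h2

/-- Identification of a summable sequence `c` from the function `g = ∑ n, c n R_n` that it defines
through the radial matrix elements `R_n`: it suffices that the Laplace transform of `g`, at
`s = 1/(1-w)`, is the power series in `w` that belongs to the candidate `b`. -/
theorem eq_of_hasSum_radialElement {d : ℕ} {c : ℕ → ℂ} (hc : Summable fun n => ‖c n‖)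
    {g : ℝ → ℂ} (hg : ∀ x, 0 < x → HasSum (fun n => c n * radialElement d n x) (g x))
    {b : ℕ → ℂ} (hb : ∀ w : ℝ, |w| < 1 / 2 → HasSum (fun n => b n *
      ((√((n + d).factorial : ℝ) : ℝ) / (√(n.factorial : ℝ) : ℝ) : ℂ) * (w : ℂ) ^ n)
      (((1 - w : ℝ) : ℂ)⁻¹ ^ (d + 1) *
        ∫ x in Set.Ioi (0 : ℝ), (laplaceWeight (1 - w)⁻¹ d x : ℂ) * g x)) : c = b := by
  have key := eq_of_hasSum_mul_pow (a := fun n => c n *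
    ((√((n + d).factorial : ℝ) : ℝ) / (√(n.factorial : ℝ) : ℝ) : ℂ)) (fun w hw => ?_) hb
  · funext n
    have h := congrFun key n
    exact mul_right_cancel₀ (div_ne_zero (sqrt_factorial_ne_zero _) (sqrt_factorial_ne_zero _)) h
  · have hw1 := abs_lt.mp hw
    have hs : 1 / 2 < (1 - w)⁻¹ := by
      rw [lt_inv_comm₀ (by norm_num) (by linarith)]
      linarith
    have h := (hasSum_laplace_radialElement hc hg hs).mul_left (((1 - w : ℝ) : ℂ)⁻¹ ^ (d + 1))
    refine h.congr_fun fun n => ?_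
    have hne : ((1 - w : ℝ) : ℂ) ≠ 0 := by
      exact_mod_cast (by linarith : (0 : ℝ) < 1 - w).ne'
    rw [Complex.ofReal_inv, inv_inv]
    have : (1 : ℂ) - ((1 - w : ℝ) : ℂ) = w := by push_cast; ring
    rw [this]
    have hne' : ((1 - w : ℝ) : ℂ)⁻¹ ^ (d + 1) ≠ 0 := pow_ne_zero _ (inv_ne_zero hne)
    rw [div_mul_eq_mul_div _ _ ((w : ℂ) ^ n), mul_left_comm, mul_div_cancel₀ _ hne', mul_assoc]

/-! ### Matrix elements of the amplifier -/

theorem sqrt_choose (n j : ℕ) : √((n + j).choose j : ℝ) =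
    √((n + j).factorial : ℝ) / (√(n.factorial : ℝ) * √(j.factorial : ℝ)) := by
  rw [← Real.sqrt_mul (by positivity), ← Real.sqrt_div (by positivity)]
  congr 1
  have h : ((n + j).choose j : ℝ) * n.factorial * j.factorial = (n + j).factorial := by
    exact_mod_cast Nat.add_choose_mul_factorial_mul_factorial n j
  have hn : (n.factorial : ℝ) ≠ 0 := by exact_mod_cast n.factorial_ne_zero
  have hj : (j.factorial : ℝ) ≠ 0 := by exact_mod_cast j.factorial_ne_zero
  rw [← h]
  field_simp

theorem amplitude_mul_amplitude_mul {G : ℝ} (hG : 1 ≤ G) (d p j : ℕ) :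
    amplitude G p j * amplitude G (p + d) j *
        (√((p + j + d).factorial : ℝ) / √((p + j).factorial : ℝ)) =
      √((p + d).factorial : ℝ) / √(p.factorial : ℝ) * ((√G)⁻¹ ^ d * G⁻¹) * G⁻¹ ^ p *
        (((j + (p + d)).choose (p + d) : ℝ) * ((G - 1) / G) ^ j) := by
  have hG0 : 0 < G := by linarith
  have hpos : ∀ n : ℕ, 0 < √(n.factorial : ℝ) := fun n =>
    Real.sqrt_pos.mpr (by exact_mod_cast n.factorial_pos)
  have hch : ((j + (p + d)).choose (p + d) : ℝ) =
      √((p + d + j).choose j : ℝ) * √((p + d + j).choose j : ℝ) := by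
    rw [Real.mul_self_sqrt (by positivity), ← Nat.choose_symm_add, add_comm]
  have hl : ((G - 1) / G) ^ j = √((G - 1) / G) ^ j * √((G - 1) / G) ^ j := by
    rw [← mul_pow, Real.mul_self_sqrt (div_nonneg (by linarith) hG0.le)]
  have hGi : G⁻¹ = (√G)⁻¹ * (√G)⁻¹ := by rw [← mul_inv, Real.mul_self_sqrt hG0.le]
  have h1 := hpos p
  have h2 := hpos j
  have h3 := hpos (p + j)
  have h4 := hpos (p + d)
  rw [hch, hl, hGi, amplitude, amplitude, sqrt_choose, sqrt_choose,
    show p + d + j = p + j + d by omega]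
  generalize (√G)⁻¹ = a
  generalize √((G - 1) / G) = b
  field_simp
  ring

/-- The Laplace transform, at `s = 1/(1-w)`, of the radial part of the output characteristic
function is the power series in `w` belonging to products of amplification amplitudes, by the
negative binomial series. -/
theorem hasSum_amplitude_laplace {G : ℝ} (hG : 1 ≤ G) (d p : ℕ) {w : ℝ} (hw : |w| < 1 / 2) :
    HasSum (fun n => (((if p ≤ n then amplitude G p (n - p) * amplitude G (p + d) (n - p)
        else 0 : ℝ) : ℂ)) *
      ((√((n + d).factorial : ℝ) : ℝ) / (√(n.factorial : ℝ) : ℝ) : ℂ) * (w : ℂ) ^ n)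
      (((1 - w : ℝ) : ℂ)⁻¹ ^ (d + 1) *
        ∫ x in Set.Ioi (0 : ℝ), (laplaceWeight (1 - w)⁻¹ d x : ℂ) *
          (radialElement d p (G * x) * ((Real.exp (-(G - 1) * x / 2) : ℝ) : ℂ))) := by
  have hw1 := abs_lt.mp hw
  have hG0 : 0 < G := by linarith
  have h1w : 0 < 1 - w := by linarith
  rw [integral_laplaceWeight_mul_amplified hG (inv_pos.mpr h1w)]
  set l : ℝ := (G - 1) / G with hl
  have hl0 : 0 ≤ l := div_nonneg (by linarith) hG0.le
  have hl1 : l < 1 := by rw [hl, div_lt_one hG0]; linarith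
  have hlw : ‖l * w‖ < 1 := by
    rw [norm_mul, Real.norm_of_nonneg hl0, Real.norm_eq_abs]
    nlinarith [abs_nonneg w]
  have h1lw : 0 < 1 - l * w := by
    have := (abs_lt.mp (Real.norm_eq_abs (l * w) ▸ hlw)).2
    linarith
  have hs' : ((1 - w)⁻¹ + G - 1) / G = (1 - l * w) / (1 - w) := by
    rw [hl]; field_simp; ring
  have hs'' : 1 - ((1 - l * w) / (1 - w))⁻¹ = w * G⁻¹ / (1 - l * w) := by
    have : G⁻¹ = 1 - l := by rw [hl]; field_simp; ring
    rw [this, inv_div, eq_div_iff h1lw.ne', sub_mul, div_mul_cancel₀ _ h1lw.ne']; ring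
  have hreal : HasSum (fun n => (if p ≤ n then amplitude G p (n - p) * amplitude G (p + d) (n - p)
        else 0 : ℝ) * (√((n + d).factorial : ℝ) / √(n.factorial : ℝ)) * w ^ n)
      ((1 - w)⁻¹ ^ (d + 1) * (√((p + d).factorial : ℝ) / √(p.factorial : ℝ) *
        ((√G)⁻¹ ^ d * G⁻¹) / ((1 - l * w) / (1 - w)) ^ (d + 1) *
          (w * G⁻¹ / (1 - l * w)) ^ p)) := by
    rw [← (add_right_injective p).hasSum_iff]
    · have h := (hasSum_choose_mul_geometric_of_norm_lt_one (p + d) hlw).mul_left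
        (√((p + d).factorial : ℝ) / √(p.factorial : ℝ) * ((√G)⁻¹ ^ d * G⁻¹) * G⁻¹ ^ p * w ^ p)
      have hval : √((p + d).factorial : ℝ) / √(p.factorial : ℝ) * ((√G)⁻¹ ^ d * G⁻¹) * G⁻¹ ^ p *
          w ^ p * (1 / (1 - l * w) ^ (p + d + 1)) =
          (1 - w)⁻¹ ^ (d + 1) * (√((p + d).factorial : ℝ) / √(p.factorial : ℝ) *
        ((√G)⁻¹ ^ d * G⁻¹) / ((1 - l * w) / (1 - w)) ^ (d + 1) *
          (w * G⁻¹ / (1 - l * w)) ^ p) := by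
        rw [show p + d + 1 = (d + 1) + p by omega, pow_add, div_pow, div_pow, mul_pow,
          inv_pow (1 - w)]
        have e1 : (1 - l * w) ^ (d + 1) ≠ 0 := (pow_pos h1lw _).ne'
        have e2 : (1 - l * w) ^ p ≠ 0 := (pow_pos h1lw _).ne'
        have e3 : (1 - w) ^ (d + 1) ≠ 0 := (pow_pos h1w _).ne'
        generalize (1 - l * w) ^ (d + 1) = X at *
        generalize (1 - l * w) ^ p = Y at *
        generalize (1 - w) ^ (d + 1) = Z at *
        field_simp
      rw [hval] at h
      refine h.congr_fun fun j => ?_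
      simp only [Function.comp_apply, le_add_iff_nonneg_right, zero_le, if_true,
        Nat.add_sub_cancel_left]
      rw [amplitude_mul_amplitude_mul hG, pow_add, mul_pow]
      ring
    · intro n hn
      have : ¬ p ≤ n := fun h => hn ⟨n - p, Nat.add_sub_cancel' h⟩
      simp [this]
  rw [hs']
  have hC := Complex.hasSum_ofReal.mpr hreal
  rw [← hs''] at hC
  push_cast at hC ⊢
  exact hC

theorem sqrt_mul_sqrt_ofReal {G x : ℝ} (hG : 1 ≤ G) :
    ((√G : ℝ) : ℂ) * ((√x : ℝ) : ℂ) = ((√(G * x) : ℝ) : ℂ) := by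
  rw [← Complex.ofReal_mul, Real.sqrt_mul (by linarith)]

/-- The output of the amplifier on `|p⟩⟨q|`, along the diagonals: its matrix elements weighted with
those of the displacement operators. -/
theorem IsQuantumLimitedAmplifier.hasSum_diagonal {G : ℝ} (hG : 1 ≤ G) {𝒜 : QuantumChannel Mode}
    (h𝒜 : IsQuantumLimitedAmplifier G 𝒜) (p q : ℕ) {x : ℝ} (hx : 0 ≤ x) (e : ℤ) :
    HasSum (fun n : ℕ => ∑' m : ℕ, if (m : ℤ) - n = e then
      channelElement 𝒜 n m p q * displacedNumberState ((√x : ℝ) : ℂ) n m else 0)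
      (if (q : ℤ) - p = e then displacedNumberState ((√(G * x) : ℝ) : ℂ) p q *
        ((Real.exp (-(G - 1) * x / 2) : ℝ) : ℂ) else 0) := by
  refine hasSum_diagonal_of_charFunction
    (𝒜.map (ketBra (numberState p) (numberState q))).2 (√x) (fun θ => ?_) e
  rw [h𝒜.charFunction_map_ketBra, ← mul_assoc, sqrt_mul_sqrt_ofReal hG, displacedNumberState_phase,
    norm_mul, Complex.norm_exp_ofReal_mul_I, Complex.norm_real, mul_one,
    Real.norm_of_nonneg (Real.sqrt_nonneg x), Real.sq_sqrt hx, mul_assoc]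

theorem summable_channelElement_add (𝒜 : QuantumChannel Mode) (p q d e : ℕ) :
    Summable fun l => ‖channelElement 𝒜 (l + d) (l + e) p q‖ :=
  summable_inner_of_mem_traceClass (𝒜.map (ketBra (numberState p) (numberState q))).2
    (orthonormal_numberState.comp _ (add_left_injective d))
    (orthonormal_numberState.comp _ (add_left_injective e))

theorem IsQuantumLimitedAmplifier.hasSum_upper {G : ℝ} (hG : 1 ≤ G) {𝒜 : QuantumChannel Mode}
    (h𝒜 : IsQuantumLimitedAmplifier G 𝒜) (p q d : ℕ) {x : ℝ} (hx : 0 ≤ x) :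
    HasSum (fun n : ℕ => channelElement 𝒜 n (n + d) p q * radialElement d n x)
      (if q = p + d then radialElement d p (G * x) *
        ((Real.exp (-(G - 1) * x / 2) : ℝ) : ℂ) else 0) := by
  have h := h𝒜.hasSum_diagonal hG p q hx d
  have hval : (if (q : ℤ) - p = d then displacedNumberState ((√(G * x) : ℝ) : ℂ) p q *
        ((Real.exp (-(G - 1) * x / 2) : ℝ) : ℂ) else 0) = (if q = p + d then
        radialElement d p (G * x) * ((Real.exp (-(G - 1) * x / 2) : ℝ) : ℂ) else 0) := by
    by_cases hq : q = p + d
    · have : (q : ℤ) - p = d := by omega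
      rw [if_pos hq, if_pos this, hq, displacedNumberState_sqrt_add d p (by positivity)]
    · have : ¬ (q : ℤ) - p = d := by omega
      rw [if_neg hq, if_neg this]
  rw [hval] at h
  refine h.congr_fun fun n => ?_
  rw [tsum_eq_single (n + d), if_pos (by push_cast; ring), displacedNumberState_sqrt_add d n hx]
  intro m hm
  rw [if_neg (by omega)]

/-- Below the diagonal the sign `(-1)^d` of the displacement matrix elements occurs both in the
input and in the output, and cancels. -/
theorem IsQuantumLimitedAmplifier.hasSum_lower {G : ℝ} (hG : 1 ≤ G) {𝒜 : QuantumChannel Mode}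
    (h𝒜 : IsQuantumLimitedAmplifier G 𝒜) (p q d : ℕ) {x : ℝ} (hx : 0 ≤ x) :
    HasSum (fun n : ℕ => channelElement 𝒜 (n + d) n p q * radialElement d n x)
      (if p = q + d then radialElement d q (G * x) *
        ((Real.exp (-(G - 1) * x / 2) : ℝ) : ℂ) else 0) := by
  have h := (h𝒜.hasSum_diagonal hG p q hx (-d)).mul_left ((-1 : ℂ) ^ d)
  have hsign : ((-1 : ℂ) ^ d) * (-1) ^ d = 1 := by rw [← mul_pow]; norm_num
  have hval : (-1 : ℂ) ^ d * (if (q : ℤ) - p = -d then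
      displacedNumberState ((√(G * x) : ℝ) : ℂ) p q *
        ((Real.exp (-(G - 1) * x / 2) : ℝ) : ℂ) else 0) =
      (if p = q + d then
        radialElement d q (G * x) * ((Real.exp (-(G - 1) * x / 2) : ℝ) : ℂ) else 0) := by
    by_cases hq : p = q + d
    · have : (q : ℤ) - p = -d := by omega
      rw [if_pos hq, if_pos this, hq, displacedNumberState_add_sqrt d q (by positivity),
        ← mul_assoc, ← mul_assoc, hsign, one_mul]
    · have : ¬ (q : ℤ) - p = -d := by omega
      rw [if_neg hq, if_neg this, mul_zero]
  rw [hval, ← (add_left_injective d).hasSum_iff] at h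
  · refine h.congr_fun fun n => ?_
    rw [Function.comp_apply, tsum_eq_single n, if_pos (by push_cast; ring),
      displacedNumberState_add_sqrt d n hx, mul_left_comm, ← mul_assoc ((-1 : ℂ) ^ d), hsign,
      one_mul]
    intro m hm
    rw [if_neg (by omega)]
  · intro n hn
    have hn' : ¬ d ≤ n := fun h => hn ⟨n - d, Nat.sub_add_cancel h⟩
    have : ∀ m : ℕ, ¬ (m : ℤ) - n = -d := fun m => by omega
    simp [this]

theorem eq_amplitude_of_hasSum {G : ℝ} (hG : 1 ≤ G) {d p : ℕ} {P : Prop} [Decidable P] {c : ℕ → ℂ}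
    (hc : Summable fun n => ‖c n‖)
    (h : ∀ x, 0 < x → HasSum (fun n => c n * radialElement d n x)
      (if P then radialElement d p (G * x) *
        ((Real.exp (-(G - 1) * x / 2) : ℝ) : ℂ) else 0)) (k : ℕ) :
    c k = if P ∧ p ≤ k then
      ((amplitude G p (k - p) * amplitude G (p + d) (k - p) : ℝ) : ℂ) else 0 := by
  by_cases hP : P
  · simp only [hP, if_true] at h
    rw [eq_of_hasSum_radialElement hc h fun w hw => hasSum_amplitude_laplace hG d p hw]
    by_cases h1 : p ≤ k <;> simp [hP, h1]
  · simp only [hP, if_false] at h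
    rw [eq_of_hasSum_radialElement hc h (b := 0) fun w hw => by simp]
    simp [hP]

/-- The amplifier is `𝒜(|n⟩⟨n'|) = ∑ j, a n j * a n' j |n+j⟩⟨n'+j|` with the amplification
amplitudes `a`. -/
theorem IsQuantumLimitedAmplifier.channelElement_eq {G : ℝ} (hG : 1 ≤ G)
    {𝒜 : QuantumChannel Mode} (h𝒜 : IsQuantumLimitedAmplifier G 𝒜) (k k' n n' : ℕ) :
    channelElement 𝒜 k k' n n' = if n ≤ k ∧ k' = n' + (k - n) then
      ((amplitude G n (k - n) * amplitude G n' (k - n) : ℝ) : ℂ) else 0 := by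
  rcases le_total k k' with hk | hk
  · obtain ⟨d, rfl⟩ := Nat.exists_eq_add_of_le hk
    have h := eq_amplitude_of_hasSum hG (summable_channelElement_add 𝒜 n n' 0 d)
      (fun x hx => h𝒜.hasSum_upper hG n n' d (le_of_lt hx)) k
    simp only [add_zero] at h
    rw [h]
    by_cases h1 : n' = n + d ∧ n ≤ k
    · rw [if_pos h1, if_pos (by omega), h1.1]
    · rw [if_neg h1, if_neg (by omega)]
  · obtain ⟨d, rfl⟩ := Nat.exists_eq_add_of_le hk
    have h := eq_amplitude_of_hasSum hG (summable_channelElement_add 𝒜 n n' d 0)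
      (fun x hx => h𝒜.hasSum_lower hG n n' d (le_of_lt hx)) k'
    simp only [add_zero] at h
    rw [h]
    by_cases h1 : n = n' + d ∧ n' ≤ k'
    · rw [if_pos h1, if_pos (by omega), h1.1, mul_comm,
        show k' + d - (n' + d) = k' - n' by omega]
    · rw [if_neg h1, if_neg (by omega)]

/-! ### The output states and their overlaps -/

section Joint

variable {A : Type u} [NormedAddCommGroup A] [InnerProductSpace ℂ A] {M : ℕ}

/-- The branch of the amplified number-diagonal-signal state in which the amplifiers have emitted
`j` quanta. -/
def branchState (G : ℝ) (r : (Fin M → ℕ) → ℝ) (χ : (Fin M → ℕ) → A) (j : Fin M → ℕ) :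
    JointSpace A M :=
  shiftedState (branchWeight G r j) χ j

theorem summable_branchWeight_sq {G : ℝ} (hG : 1 ≤ G) {r : (Fin M → ℕ) → ℝ} (hr : ∀ n, 0 ≤ r n)
    (hr_sum : Summable r) (j : Fin M → ℕ) : Summable fun n => branchWeight G r j n ^ 2 :=
  hr_sum.of_nonneg_of_le (fun _ => sq_nonneg _) fun n => branchWeight_sq_le hG hr j n

/-- The branch overlaps `c j`, summed over `j` before `n`: for fixed `n` the amplitudes sum to
`ν^(n+M)`. -/
theorem exists_hasSum_inner_branchState {G G' : ℝ} (hG : 1 ≤ G) (hG' : 1 ≤ G')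
    {r s : (Fin M → ℕ) → ℝ} (hr : ∀ n, 0 ≤ r n) (hr_sum : Summable r) (hs : ∀ n, 0 ≤ s n)
    (hs_sum : Summable s) {χ : (Fin M → ℕ) → A} (hχ : Orthonormal ℂ χ) :
    ∃ (c : (Fin M → ℕ) → ℝ) (F : ℝ), (∀ j, 0 ≤ c j) ∧
      (∀ j, ⟪branchState G r χ j, branchState G' s χ j⟫_ℂ = c j) ∧ HasSum c F ∧
      HasSum (fun n => √(r n * s n) *
        (√(G * G') - √((G - 1) * (G' - 1)))⁻¹ ^ ((∑ m, n m) + M)) F := by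
  have hν := one_le_sqrt_mul_sub_sqrt_mul hG hG'
  set ν := (√(G * G') - √((G - 1) * (G' - 1)))⁻¹ with hνdef
  have hν0 : 0 ≤ ν := inv_nonneg.mpr (by linarith)
  have hν1 : ν ≤ 1 := inv_le_one_of_one_le₀ hν
  have hterm : ∀ n j : Fin M → ℕ, branchWeight G r j n * branchWeight G' s j n =
      √(r n * s n) * (multiAmplitude G n j * multiAmplitude G' n j) := fun n j => by
    rw [branchWeight, branchWeight, Real.sqrt_mul (hr n)]
    ring
  have hg : Summable fun n => √(r n * s n) * ν ^ ((∑ m, n m) + M) := by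
    refine ((hr_sum.add hs_sum).div_const 2).of_nonneg_of_le (fun n => by positivity) fun n => ?_
    have h1 : √(r n * s n) ≤ (r n + s n) / 2 := by
      rw [Real.sqrt_le_left (by linarith [hr n, hs n])]
      nlinarith [sq_nonneg (r n - s n)]
    exact (mul_le_of_le_one_right (Real.sqrt_nonneg _) (pow_le_one₀ hν0 hν1)).trans h1
  have hinner := fun j => hasSum_inner_shiftedState hχ (summable_branchWeight_sq hG hr hr_sum j)
    (summable_branchWeight_sq hG' hs hs_sum j) j
  have hrow : ∀ j, HasSum (fun n => branchWeight G r j n * branchWeight G' s j n)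
      (∑' n, branchWeight G r j n * branchWeight G' s j n) := fun j => by
    refine Summable.hasSum ?_
    exact_mod_cast (hinner j).summable
  refine ⟨fun j => ∑' n, branchWeight G r j n * branchWeight G' s j n, _, fun j => ?_, fun j => ?_,
    ?_, hg.hasSum⟩
  · refine tsum_nonneg fun n => ?_
    rw [hterm]
    exact mul_nonneg (Real.sqrt_nonneg _)
      (mul_nonneg (multiAmplitude_nonneg _ _ _) (multiAmplitude_nonneg _ _ _))
  · rw [branchState, branchState, ← (hinner j).tsum_eq, Complex.ofReal_tsum]
  · refine hasSum_comm_of_nonneg (f := fun n j => branchWeight G r j n * branchWeight G' s j n)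
      (fun n j => ?_) (fun n => ?_) hg.hasSum hrow
    · rw [hterm]
      exact mul_nonneg (Real.sqrt_nonneg _)
        (mul_nonneg (multiAmplitude_nonneg _ _ _) (multiAmplitude_nonneg _ _ _))
    · simp only [hterm]
      exact (hasSum_multiAmplitude_mul hG hG' n).mul_left _

theorem inner_branchState_of_ne {G G' : ℝ} (hG : 1 ≤ G) (hG' : 1 ≤ G')
    {r s : (Fin M → ℕ) → ℝ} (hr : ∀ n, 0 ≤ r n) (hr_sum : Summable r) (hs : ∀ n, 0 ≤ s n)
    (hs_sum : Summable s) {χ : (Fin M → ℕ) → A} (hχ : Orthonormal ℂ χ) {i j : Fin M → ℕ}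
    (hij : i ≠ j) : ⟪branchState G r χ i, branchState G' s χ j⟫_ℂ = 0 :=
  inner_shiftedState_of_ne hχ (summable_branchWeight_sq hG hr hr_sum i)
    (summable_branchWeight_sq hG' hs hs_sum j) hij

theorem hasSum_norm_branchState_sq {G : ℝ} (hG : 1 ≤ G) {r : (Fin M → ℕ) → ℝ} (hr : ∀ n, 0 ≤ r n)
    (hr_sum : HasSum r 1) {χ : (Fin M → ℕ) → A} (hχ : Orthonormal ℂ χ) :
    HasSum (fun j => ‖branchState G r χ j‖ ^ 2) 1 := by
  obtain ⟨c, F, -, hc, hcF, hF⟩ :=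
    exists_hasSum_inner_branchState hG hG hr hr_sum.summable hr hr_sum.summable hχ
  have h1 : √(G * G) - √((G - 1) * (G - 1)) = 1 := by
    rw [Real.sqrt_mul_self (by linarith), Real.sqrt_mul_self (by linarith)]
    ring
  have hF1 : F = 1 := by
    refine hF.unique (hr_sum.congr_fun fun n => ?_)
    rw [h1, inv_one, one_pow, mul_one, Real.sqrt_mul_self (hr n)]
  rw [← hF1]
  refine hcF.congr_fun fun j => ?_
  have h2 := hc j
  rw [inner_self_eq_norm_sq_to_K] at h2
  have h3 : ((‖branchState G r χ j‖ ^ 2 : ℝ) : ℂ) = c j := by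
    push_cast
    exact h2
  exact Complex.ofReal_injective h3

open scoped Classical in
theorem IsQuantumLimitedAmplifier.prod_channelElement {G : ℝ} (hG : 1 ≤ G)
    {𝒜 : QuantumChannel Mode} (h𝒜 : IsQuantumLimitedAmplifier G 𝒜) (k k' n n' : Fin M → ℕ) :
    ∏ m, channelElement 𝒜 (k m) (k' m) (n m) (n' m) = if n ≤ k ∧ k' = n' + (k - n) then
      ((multiAmplitude G n (k - n) * multiAmplitude G n' (k - n) : ℝ) : ℂ) else 0 := by
  simp only [h𝒜.channelElement_eq hG, Finset.prod_ite_zero]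
  have : (∀ m ∈ Finset.univ, n m ≤ k m ∧ k' m = n' m + (k m - n m)) ↔
      n ≤ k ∧ k' = n' + (k - n) := by
    simp only [Finset.mem_univ, true_implies, forall_and, Pi.le_def, funext_iff, Pi.add_apply,
      Pi.sub_apply]
  simp only [this]
  refine if_congr Iff.rfl ?_ rfl
  rw [multiAmplitude, multiAmplitude, ← Finset.prod_mul_distrib, Complex.ofReal_prod]
  rfl

theorem isProductChannelOutput_unique {Φ : QuantumChannel Mode}
    {σ ρ ρ' : JointSpace A M →L[ℂ] JointSpace A M} (h : IsProductChannelOutput Φ σ ρ)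
    (h' : IsProductChannelOutput Φ σ ρ') : ρ = ρ' := by
  ext1 v
  have hbasis : ∀ (k' : Fin M → ℕ) (a' : A), ρ (tensorNumber a' k') = ρ' (tensorNumber a' k') :=
    fun k' a' => by
      refine lp.ext (funext fun k => ?_)
      refine ext_inner_left ℂ fun a => ?_
      rw [← inner_tensorNumber, ← inner_tensorNumber, h, h']
  have hv := lp.hasSum_single (E := fun _ : Fin M → ℕ => A) (p := 2) (by simp) v
  refine (hv.mapL ρ).unique ((hv.mapL ρ').congr_fun fun k => ?_)
  exact hbasis k (v k)

variable [CompleteSpace A]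

/-- The output state is the mixture of its branches: in `⟨k| ρ |k'⟩`, the numbers of emitted quanta
`j = k - n = k' - n'` label the terms. -/
theorem isProductChannelOutput_frameOp {G : ℝ} (hG : 1 ≤ G) {𝒜 : QuantumChannel Mode}
    (h𝒜 : IsQuantumLimitedAmplifier G 𝒜) {r : (Fin M → ℕ) → ℝ} (hr : ∀ n, 0 ≤ r n)
    (hr_sum : HasSum r 1) {χ : (Fin M → ℕ) → A} (hχ : Orthonormal ℂ χ) :
    IsProductChannelOutput 𝒜 (InnerProductSpace.rankOne ℂ (ndsState r χ) (ndsState r χ))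
      (frameOp (branchState G r χ)) := by
  classical
  intro k k' a a'
  have hw := fun j => summable_branchWeight_sq hG hr hr_sum.summable j
  have hw0 : Summable fun n => (√(r n)) ^ 2 := by
    simpa only [Real.sq_sqrt (hr _)] using hr_sum.summable
  have hin : ∀ (a : A) n, ⟪tensorNumber a n, ndsState r χ⟫_ℂ = (√(r n) : ℝ) * ⟪a, χ n⟫_ℂ :=
    fun a n => by
      rw [inner_tensorNumber, ndsState_eq_shiftedState, shiftedState_apply hχ hw0,
        if_pos (show (0 : Fin M → ℕ) ≤ n from fun _ => Nat.zero_le _), tsub_zero, inner_smul_right]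
  have hbr : ∀ (a : A) k j, ⟪tensorNumber a k, branchState G r χ j⟫_ℂ =
      if j ≤ k then (branchWeight G r j (k - j) : ℂ) * ⟪a, χ (k - j)⟫_ℂ else 0 := fun a k j => by
    rw [inner_tensorNumber, branchState, shiftedState_apply hχ (hw j)]
    split_ifs
    · rw [inner_smul_right]
    · rw [inner_zero_right]
  set g : (Fin M → ℕ) → ℂ := fun j => ⟪tensorNumber a k, branchState G r χ j⟫_ℂ *
    ⟪branchState G r χ j, tensorNumber a' k'⟫_ℂ with hg
  have hLHS : ⟪tensorNumber a k, frameOp (branchState G r χ) (tensorNumber a' k')⟫_ℂ =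
      ∑' j, g j :=
    (hasSum_inner_frameOp (hasSum_norm_branchState_sq hG hr hr_sum hχ).summable _ _).tsum_eq.symm
  have hinner : ∀ n, (∑' n' : Fin M → ℕ, (∏ m, channelElement 𝒜 (k m) (k' m) (n m) (n' m)) *
      ⟪tensorNumber a n, InnerProductSpace.rankOne ℂ (ndsState r χ) (ndsState r χ)
        (tensorNumber a' n')⟫_ℂ) = if n ≤ k then g (k - n) else 0 := fun n => by
    simp only [h𝒜.prod_channelElement hG]
    by_cases hn : n ≤ k
    · rw [tsum_eq_single (k' - (k - n)), if_pos hn]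
      · rw [InnerProductSpace.rankOne_apply, inner_smul_right, hin, ← inner_conj_symm, hin]
        simp only [hg]
        rw [hbr, ← inner_conj_symm (branchState G r χ (k - n)), hbr, if_pos tsub_le_self,
          tsub_tsub_cancel_of_le hn]
        by_cases hk : k - n ≤ k'
        · rw [if_pos ⟨hn, (tsub_add_cancel_of_le hk).symm⟩, if_pos hk, branchWeight, branchWeight]
          simp only [map_mul, Complex.conj_ofReal]
          push_cast
          ring
        · rw [if_neg hk, if_neg, zero_mul, map_zero, mul_zero]
          rintro ⟨-, h2⟩
          exact hk (h2 ▸ le_add_self)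
      · intro n' hn'
        rw [if_neg, zero_mul]
        rintro ⟨-, h2⟩
        exact hn' (by rw [h2, add_tsub_cancel_right])
    · rw [if_neg hn]
      have : ∀ n', ¬ (n ≤ k ∧ k' = n' + (k - n)) := fun n' h => hn h.1
      simp [this]
  rw [hLHS]
  simp only [hinner]
  rw [tsum_eq_sum (s := Finset.Icc 0 k), tsum_eq_sum (s := Finset.Icc 0 k)]
  · refine Finset.sum_nbij' (fun j => k - j) (fun n => k - n) ?_ ?_ ?_ ?_ ?_
    · exact fun j _ => Finset.mem_Icc.mpr ⟨fun _ => Nat.zero_le _, tsub_le_self⟩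
    · exact fun j _ => Finset.mem_Icc.mpr ⟨fun _ => Nat.zero_le _, tsub_le_self⟩
    · exact fun j hj => tsub_tsub_cancel_of_le (Finset.mem_Icc.mp hj).2
    · exact fun j hj => tsub_tsub_cancel_of_le (Finset.mem_Icc.mp hj).2
    · intro j hj
      rw [if_pos tsub_le_self, tsub_tsub_cancel_of_le (Finset.mem_Icc.mp hj).2]
  · intro n hn
    rw [if_neg fun h => hn (Finset.mem_Icc.mpr ⟨fun _ => Nat.zero_le _, h⟩)]
  · intro j hj
    simp only [hg]
    rw [hbr, if_neg fun h => hj (Finset.mem_Icc.mpr ⟨fun _ => Nat.zero_le _, h⟩), zero_mul]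

theorem isDensityOperator_frameOp_branchState {G : ℝ} (hG : 1 ≤ G) {r : (Fin M → ℕ) → ℝ}
    (hr : ∀ n, 0 ≤ r n) (hr_sum : HasSum r 1) {χ : (Fin M → ℕ) → A} (hχ : Orthonormal ℂ χ) :
    IsDensityOperator (frameOp (branchState G r χ)) := by
  have h := hasSum_norm_branchState_sq hG hr hr_sum hχ
  refine ⟨isPositive_frameOp h.summable, ?_⟩
  have h1 := hasTrace_frameOp h.summable h
  rwa [Complex.ofReal_one] at h1

end Joint

theorem inv_sqrt_sub_sqrt_eq_inv_cosh {τ τ' : ℝ} (hτ : 0 ≤ τ) (hτ' : 0 ≤ τ') :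
    (√(Real.cosh τ ^ 2 * Real.cosh τ' ^ 2) -
      √((Real.cosh τ ^ 2 - 1) * (Real.cosh τ' ^ 2 - 1)))⁻¹ = (Real.cosh (τ' - τ))⁻¹ := by
  have h1 : ∀ t, Real.cosh t ^ 2 - 1 = Real.sinh t ^ 2 := fun t => by
    rw [Real.cosh_sq]
    ring
  rw [h1, h1, ← mul_pow, ← mul_pow,
    Real.sqrt_sq (mul_nonneg (Real.cosh_pos τ).le (Real.cosh_pos τ').le),
    Real.sqrt_sq (mul_nonneg (Real.sinh_nonneg_iff.mpr hτ) (Real.sinh_nonneg_iff.mpr hτ')),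
    Real.cosh_sub]
  ring

end

theorem theoremA1 {A : Type u} [NormedAddCommGroup A] [InnerProductSpace ℂ A] [CompleteSpace A]
    (M : ℕ)
    (r s : (Fin M → ℕ) → ℝ) (hr : ∀ n, 0 ≤ r n) (hr_sum : HasSum r 1)
    (hs : ∀ n, 0 ≤ s n) (hs_sum : HasSum s 1)
    (χ : (Fin M → ℕ) → A) (hχ : Orthonormal ℂ χ)
    (G G' : ℝ) (hG : 1 ≤ G) (hG' : 1 ≤ G')
    (𝒜 𝒜' : QuantumChannel Mode)
    (h𝒜 : IsQuantumLimitedAmplifier G 𝒜) (h𝒜' : IsQuantumLimitedAmplifier G' 𝒜')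
    (ν : ℝ) (hν : ν = (√(G * G') - √((G - 1) * (G' - 1)))⁻¹) :
    let Ψ : JointSpace A M →L[ℂ] JointSpace A M :=
      InnerProductSpace.rankOne ℂ (ndsState r χ) (ndsState r χ)
    let Ψ' : JointSpace A M →L[ℂ] JointSpace A M :=
      InnerProductSpace.rankOne ℂ (ndsState s χ) (ndsState s χ)
    -- the outputs exist, and are states whose fidelity is the stated sum
    (∃ ρ : JointSpace A M →L[ℂ] JointSpace A M, IsProductChannelOutput 𝒜 Ψ ρ) ∧
    (∃ ρ' : JointSpace A M →L[ℂ] JointSpace A M, IsProductChannelOutput 𝒜' Ψ' ρ') ∧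
    (∀ ρ ρ' : JointSpace A M →L[ℂ] JointSpace A M,
      IsProductChannelOutput 𝒜 Ψ ρ → IsProductChannelOutput 𝒜' Ψ' ρ' →
      IsDensityOperator ρ ∧ IsDensityOperator ρ' ∧
      ∃ F : ℝ, HasSum (fun n => √(r n * s n) * ν ^ ((∑ m, n m) + M)) F ∧ HasFidelity ρ ρ' F) ∧
    -- the two expressions of `ν`, and its range
    0 < ν ∧ ν ≤ 1 ∧
    (∀ τ τ' : ℝ, 0 ≤ τ → 0 ≤ τ' → G = Real.cosh τ ^ 2 → G' = Real.cosh τ' ^ 2 →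
      ν = (Real.cosh (τ' - τ))⁻¹) := by
  intro Ψ Ψ'
  have hρ := isProductChannelOutput_frameOp hG h𝒜 hr hr_sum hχ
  have hρ' := isProductChannelOutput_frameOp hG' h𝒜' hs hs_sum hχ
  have hν1 := one_le_sqrt_mul_sub_sqrt_mul hG hG'
  refine ⟨⟨_, hρ⟩, ⟨_, hρ'⟩, fun ρ ρ' h h' => ?_, ?_, ?_, fun τ τ' hτ hτ' hGτ hGτ' => ?_⟩
  · obtain rfl := isProductChannelOutput_unique h hρ
    obtain rfl := isProductChannelOutput_unique h' hρ'
    refine ⟨isDensityOperator_frameOp_branchState hG hr hr_sum hχ,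
      isDensityOperator_frameOp_branchState hG' hs hs_sum hχ, ?_⟩
    obtain ⟨c, F, hc0, hc, hcF, hF⟩ :=
      exists_hasSum_inner_branchState hG hG' hr hr_sum.summable hs hs_sum.summable hχ
    rw [← hν] at hF
    exact ⟨F, hF, hasFidelity_frameOp (hasSum_norm_branchState_sq hG hr hr_sum hχ).summable
      (hasSum_norm_branchState_sq hG' hs hs_sum hχ).summable
      (fun i j => inner_branchState_of_ne hG hG hr hr_sum.summable hr hr_sum.summable hχ) hc
      (fun i j => inner_branchState_of_ne hG hG' hr hr_sum.summable hs hs_sum.summable hχ)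
      hc0 hcF⟩
  · rw [hν]
    exact inv_pos.mpr (by linarith)
  · rw [hν]
    exact inv_le_one_of_one_le₀ hν1
  · rw [hν, hGτ, hGτ']
    exact inv_sqrt_sub_sqrt_eq_inv_cosh hτ hτ'
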